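/- Let $k$ be a field and let $Q=(Q_0,Q_1;s,t)$ be a finite quiver (finitely many vertices and arrows). Let $kQ$ be its path algebra, where the product $qp$ of two paths means "first $p$, then $q$", let $J$ be the two-sided ideal of $kQ$ generated by the arrows, and let $\Lambda=kQ/J^2$. Let $Q^{\mathrm{op}}$ be the opposite quiver, with reversed arrows $\alpha^*\colon t(\alpha)\to s(\alpha)$ for $\alpha\in Q_1$. All modules are left modules. A differential projective $\Lambda$-module is a pair $(M,d)$ with $M$ a projective $\Lambda$-module and $d$ an endomorphism of $M$ with $d^2=0$; its shift is $\Sigma(M,d)=(M,-d)$. A morphism $f\colon(M,d)\to(N,\delta)$ is a $\Lambda$-module map with $fd=\delta f$; it is null-homotopic if $f=rd+\delta r$ for some $\Lambda$-module map $r\colon M\to N$. The module $(M,d)$ is contractible if its identity map is null-homotopic, and reduced if it has no nonzero contractible direct summand (as a differential module). Let $\mathrm{Diff}(\Lambda\text{-}\mathrm{Proj})$ be the category of differential projective $\Lambda$-modules, $\mathrm{Diff}_0(\Lambda\text{-}\mathrm{Proj})$ its full subcategory of reduced objects, and $\underline{\mathrm{Diff}}(\Lambda\text{-}\mathrm{Proj})$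 the homotopy category, obtained from $\mathrm{Diff}(\Lambda\text{-}\mathrm{Proj})$ by factoring out the null-homotopic maps. Let $\operatorname{rad}M$ be the intersection of all maximal submodules of $M$. Then taking the top defines a functor $$F\colon \mathrm{Diff}_0(\Lambda\text{-}\mathrm{Proj})\to kQ^{\mathrm{op}}\text{-}\mathrm{Mod},$$ as follows. As a $k$-vector space $F(M,d)=M/\operatorname{rad}M$, with $F(M,d)_i=e_i(M/\operatorname{rad}M)$ for $i\in Q_0$, and $F(f)$ is the map induced by $f$. For every $x\in M$ one can write $d(x)=\sum_{\beta\in Q_1}\beta y_\beta$ with $y_\beta\in M$, and for every such expression and every arrow $\alpha$, the arrow $\alpha^*$ sends the class of $x$ in $M/\operatorname{rad}M$ to the class of $e_{s(\alpha)}y_\alpha$. Moreover: 1. $F$ is full, dense (every $kQ^{\mathrm{op}}$-module is isomorphic to some $F(M)$), and detects isomorphisms (if $F(f)$ is an isomorphism, then so is $f$). 2. $F$ is exact, in the sense that if $0\to L\to M\to N\to0$ is a short exact sequence of differential modules with $L,M,N$ reduced differential projective, then $0\to F(L)\to F(M)\to F(N)\to0$ is exact; and $\mathrm{Diff}_0(\Lambda\text{-}\mathrm{Proj})$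 has all small coproducts and $F$ commutes with them. 3. $F(f)=0$ for every null-homotopic map $f$ in $\mathrm{Diff}_0(\Lambda\text{-}\mathrm{Proj})$. 4. For all $M,N$ in $\mathrm{Diff}_0(\Lambda\text{-}\mathrm{Proj})$ there is an isomorphism of $k$-vector spaces $$\underline{\mathrm{Diff}}(\Lambda\text{-}\mathrm{Proj})(M,N)\;\cong\;\operatorname{Hom}_{kQ^{\mathrm{op}}}(F(M),F(N))\oplus\operatorname{Ext}^1_{kQ^{\mathrm{op}}}(F(M),F(\Sigma N)).$$ -/

import Mathlib

open CategoryTheory Limits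

universe u

section PathAlgebra

/-- A path of the quiver `V` together with its source and its target (trivial paths included). -/
structure QuiverPath (V : Type u) [Quiver.{u} V] : Type u where
  src : V
  tgt : V
  path : Quiver.Path src tgt

namespace QuiverPath

variable {V : Type u} [Quiver.{u} V]

/-- The trivial path `e_i`. -/
def trivial (i : V) : QuiverPath V := ⟨i, i, Quiver.Path.nil⟩

/-- An arrow, regarded as a path of length one. -/
def ofArrow {i j : V} (a : i ⟶ j) : QuiverPath V := ⟨i, j, a.toPath⟩

/-- The composite `q p` ("first `p`, then `q`") of two paths with `t(p) = s(q)`. -/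
def comp (q p : QuiverPath V) (h : p.tgt = q.src) : QuiverPath V :=
  ⟨p.src, q.tgt, p.path.comp (q.path.cast h.symm rfl)⟩

theorem comp_assoc (r q p : QuiverPath V) (h : q.tgt = r.src) (h' : p.tgt = q.src) :
    (r.comp q h).comp p h' = r.comp (q.comp p h') h := by
  obtain ⟨a, b, p⟩ := p
  obtain ⟨c, d, q⟩ := q
  obtain ⟨e, f, r⟩ := r
  dsimp at h h'
  subst h h'
  simp [comp]

theorem comp_trivial (p : QuiverPath V) : p.comp (trivial p.src) rfl = p := by
  simp [comp, trivial]

theorem trivial_comp (p : QuiverPath V) : (trivial p.tgt).comp p rfl = p := by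
  simp [comp, trivial]

end QuiverPath

/-- The path algebra `kQ` of the quiver `Q = V`: the `k`-vector space with basis the set of all
paths.  The product `q p` of two paths is their composite (first `p`, then `q`) when
`t(p) = s(q)`, and `0` otherwise. -/
def PathAlgebra (k V : Type u) [Field k] [Quiver.{u} V] : Type u := QuiverPath V →₀ k

namespace PathAlgebra

variable {k V : Type u} [Field k] [Quiver.{u} V]

noncomputable instance : AddCommGroup (PathAlgebra k V) :=
  inferInstanceAs (AddCommGroup (QuiverPath V →₀ k))

noncomputable instance : Module k (PathAlgebra k V) :=
  inferInstanceAs (Module k (QuiverPath V →₀ k))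

variable (k) in
/-- The basis element of the path algebra given by a path. -/
noncomputable def ofPath (p : QuiverPath V) : PathAlgebra k V := Finsupp.single p (1 : k)

/-- The linear map out of the path algebra with prescribed values on the paths. -/
noncomputable def lift {W : Type*} [AddCommGroup W] [Module k W] (f : QuiverPath V → W) :
    PathAlgebra k V →ₗ[k] W :=
  (Finsupp.lift W k (QuiverPath V) f : (QuiverPath V →₀ k) →ₗ[k] W)

theorem lift_ofPath {W : Type*} [AddCommGroup W] [Module k W] (f : QuiverPath V → W)
    (p : QuiverPath V) : lift f (ofPath k p) = f p := by
  have h : (Finsupp.lift W k (QuiverPath V) f) (Finsupp.single p (1 : k)) = f p := by simp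
  exact h

open Classical in
variable (k) in
/-- The product of two paths in the path algebra. -/
noncomputable def pathMul (q p : QuiverPath V) : PathAlgebra k V :=
  if h : p.tgt = q.src then ofPath k (q.comp p h) else 0

/-- The multiplication of the path algebra: the bilinear extension of `pathMul`. -/
noncomputable def mulMap : PathAlgebra k V →ₗ[k] PathAlgebra k V →ₗ[k] PathAlgebra k V :=
  lift fun q => lift fun p => pathMul k q p

noncomputable instance : Mul (PathAlgebra k V) := ⟨fun x y => mulMap x y⟩

theorem mul_def (x y : PathAlgebra k V) : x * y = mulMap x y := rfl

theorem ofPath_mul_ofPath (q p : QuiverPath V) : ofPath k q * ofPath k p = pathMul k q p := by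
  rw [mul_def, mulMap, lift_ofPath, lift_ofPath]

theorem ofPath_mul_ofPath_of_eq (q p : QuiverPath V) (h : p.tgt = q.src) :
    ofPath k q * ofPath k p = ofPath k (q.comp p h) := by
  rw [ofPath_mul_ofPath, pathMul, dif_pos h]

theorem ofPath_mul_ofPath_of_ne (q p : QuiverPath V) (h : p.tgt ≠ q.src) :
    ofPath k q * ofPath k p = 0 := by
  rw [ofPath_mul_ofPath, pathMul, dif_neg h]

variable (k) in
/-- The trivial path `e_i` as an idempotent of the path algebra. -/
noncomputable def vertex (i : V) : PathAlgebra k V := ofPath k (QuiverPath.trivial i)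

variable (k) in
/-- An arrow as an element of the path algebra. -/
noncomputable def arrow {i j : V} (a : i ⟶ j) : PathAlgebra k V := ofPath k (QuiverPath.ofArrow a)

/-- The unit element of the path algebra is the sum of all the trivial paths. -/
noncomputable instance [Fintype V] : One (PathAlgebra k V) := ⟨∑ i : V, vertex k i⟩

theorem one_def [Fintype V] : (1 : PathAlgebra k V) = ∑ i : V, vertex k i := rfl

/-- To prove an additive statement about elements of the path algebra, it suffices to treat scalar
multiples of paths. -/
theorem induction {P : PathAlgebra k V → Prop} (x : PathAlgebra k V) (h0 : P 0)
    (hadd : ∀ x y, P x → P y → P (x + y)) (hpath : ∀ (c : k) p, P (c • ofPath k p)) : P x := by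
  refine Finsupp.induction_linear x h0 hadd fun p c => ?_
  have h : c • (Finsupp.single p (1 : k) : QuiverPath V →₀ k) = Finsupp.single p c := by simp
  exact h ▸ hpath c p

protected theorem add_mul' (x y z : PathAlgebra k V) : (x + y) * z = x * z + y * z := by
  simp [mul_def]

protected theorem mul_add' (x y z : PathAlgebra k V) : x * (y + z) = x * y + x * z := by
  simp [mul_def]

protected theorem smul_mul' (c : k) (x y : PathAlgebra k V) : (c • x) * y = c • (x * y) := by
  simp [mul_def]

protected theorem mul_smul' (c : k) (x y : PathAlgebra k V) : x * (c • y) = c • (x * y) := by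
  simp [mul_def]

protected theorem zero_mul' (x : PathAlgebra k V) : 0 * x = 0 := by simp [mul_def]

protected theorem mul_zero' (x : PathAlgebra k V) : x * 0 = 0 := by simp [mul_def]

protected theorem mul_assoc' (x y z : PathAlgebra k V) : x * y * z = x * (y * z) := by
  induction x using induction with
  | h0 => simp only [PathAlgebra.zero_mul']
  | hadd a b ha hb => simp only [PathAlgebra.add_mul', ha, hb]
  | hpath c r =>
  simp only [PathAlgebra.smul_mul']
  congr 1
  induction y using induction with
  | h0 => simp only [PathAlgebra.zero_mul', PathAlgebra.mul_zero']
  | hadd a b ha hb => simp only [PathAlgebra.add_mul', PathAlgebra.mul_add', ha, hb]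
  | hpath c q =>
  simp only [PathAlgebra.smul_mul', PathAlgebra.mul_smul']
  congr 1
  induction z using induction with
  | h0 => simp only [PathAlgebra.mul_zero']
  | hadd a b ha hb => simp only [PathAlgebra.mul_add', ha, hb]
  | hpath c p =>
  simp only [PathAlgebra.mul_smul']
  congr 1
  by_cases h : q.tgt = r.src
  · by_cases h' : p.tgt = q.src
    · rw [ofPath_mul_ofPath_of_eq _ _ h, ofPath_mul_ofPath_of_eq _ _ h',
        ofPath_mul_ofPath_of_eq (r.comp q h) p h', ofPath_mul_ofPath_of_eq r (q.comp p h') h,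
        QuiverPath.comp_assoc]
    · rw [ofPath_mul_ofPath_of_eq _ _ h, ofPath_mul_ofPath_of_ne _ _ h',
        ofPath_mul_ofPath_of_ne (r.comp q h) p h', PathAlgebra.mul_zero']
  · by_cases h' : p.tgt = q.src
    · rw [ofPath_mul_ofPath_of_ne _ _ h, ofPath_mul_ofPath_of_eq _ _ h',
        ofPath_mul_ofPath_of_ne r (q.comp p h') h, PathAlgebra.zero_mul']
    · rw [ofPath_mul_ofPath_of_ne _ _ h, ofPath_mul_ofPath_of_ne _ _ h',
        PathAlgebra.zero_mul', PathAlgebra.mul_zero']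

theorem vertex_mul_ofPath (i : V) (p : QuiverPath V) [Decidable (p.tgt = i)] :
    vertex k i * ofPath k p = if p.tgt = i then ofPath k p else 0 := by
  split_ifs with h
  · subst h
    exact (ofPath_mul_ofPath_of_eq _ _ rfl).trans (congrArg _ p.trivial_comp)
  · exact ofPath_mul_ofPath_of_ne _ _ h

theorem ofPath_mul_vertex (i : V) (p : QuiverPath V) [Decidable (p.src = i)] :
    ofPath k p * vertex k i = if p.src = i then ofPath k p else 0 := by
  split_ifs with h
  · subst h
    exact (ofPath_mul_ofPath_of_eq _ _ rfl).trans (congrArg _ p.comp_trivial)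
  · exact ofPath_mul_ofPath_of_ne _ _ fun h' => h h'.symm

variable [Fintype V]

protected theorem one_mul' (x : PathAlgebra k V) : 1 * x = x := by
  classical
  induction x using induction with
  | h0 => exact PathAlgebra.mul_zero' _
  | hadd a b ha hb => rw [PathAlgebra.mul_add', ha, hb]
  | hpath c p =>
    rw [PathAlgebra.mul_smul', one_def, mul_def, map_sum, LinearMap.sum_apply]
    simp only [← mul_def, vertex_mul_ofPath, Finset.sum_ite_eq, Finset.mem_univ, if_true]

protected theorem mul_one' (x : PathAlgebra k V) : x * 1 = x := by
  classical
  induction x using induction with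
  | h0 => exact PathAlgebra.zero_mul' _
  | hadd a b ha hb => rw [PathAlgebra.add_mul', ha, hb]
  | hpath c p =>
    rw [PathAlgebra.smul_mul', one_def, mul_def, map_sum]
    simp only [← mul_def, ofPath_mul_vertex, Finset.sum_ite_eq, Finset.mem_univ, if_true]

noncomputable instance : Ring (PathAlgebra k V) where
  __ := (inferInstance : AddCommGroup (PathAlgebra k V))
  left_distrib := PathAlgebra.mul_add'
  right_distrib := PathAlgebra.add_mul'
  zero_mul := PathAlgebra.zero_mul'
  mul_zero := PathAlgebra.mul_zero'
  mul_assoc := PathAlgebra.mul_assoc'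
  one_mul := PathAlgebra.one_mul'
  mul_one := PathAlgebra.mul_one'

noncomputable instance : Algebra k (PathAlgebra k V) :=
  Algebra.ofModule PathAlgebra.smul_mul' PathAlgebra.mul_smul'

variable (k V) in
/-- The arrow ideal `J` of the path algebra: the two-sided ideal generated by all arrows. -/
noncomputable def arrowIdeal : Ideal (PathAlgebra k V) :=
  (TwoSidedIdeal.span {x | ∃ (i j : V) (a : i ⟶ j), x = arrow k a}).asIdeal

instance : (arrowIdeal k V).IsTwoSided := by unfold arrowIdeal; infer_instance

end PathAlgebra

end PathAlgebra

section RadicalSquareZero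

/-- The algebra `kQ/J²` with radical square zero, `J` being the arrow ideal of `kQ`. -/
abbrev RadSqZero (k V : Type u) [Field k] [Quiver.{u} V] [Fintype V] : Type u :=
  PathAlgebra k V ⧸ (PathAlgebra.arrowIdeal k V) ^ 2

namespace RadSqZero

variable {V : Type u} (k : Type u) [Field k] [Quiver.{u} V] [Fintype V]

/-- The class of the trivial path `e_i` in `kQ/J²`. -/
noncomputable def vertex (i : V) : RadSqZero k V :=
  Ideal.Quotient.mk ((PathAlgebra.arrowIdeal k V) ^ 2) (PathAlgebra.vertex k i)

/-- The class of an arrow in `kQ/J²`. -/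
noncomputable def arrow {i j : V} (a : i ⟶ j) : RadSqZero k V :=
  Ideal.Quotient.mk ((PathAlgebra.arrowIdeal k V) ^ 2) (PathAlgebra.arrow k a)

end RadSqZero

/-- The set of vertices of the opposite of a finite quiver is finite. -/
instance opFintype (V : Type u) [Fintype V] : Fintype Vᵒᵖ :=
  Fintype.ofEquiv V Opposite.equivToOpposite

end RadicalSquareZero

section DifferentialModules

/-- A differential module over a ring `R`: an `R`-module with an endomorphism `d`, `d² = 0`. -/
structure DiffMod (R : Type u) [Ring R] : Type (u + 1) where
  carrier : ModuleCat.{u} R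
  d : carrier ⟶ carrier
  d_sq : d ≫ d = 0

namespace DiffMod

variable {R : Type u} [Ring R]

/-- Differential module maps: the `R`-module maps that commute with the differentials. -/
@[ext]
structure Hom (M N : DiffMod R) : Type u where
  hom : M.carrier ⟶ N.carrier
  comm : M.d ≫ hom = hom ≫ N.d

instance : Category (DiffMod R) where
  Hom := Hom
  id M := ⟨𝟙 _, by simp⟩
  comp f g := ⟨f.hom ≫ g.hom, by rw [← Category.assoc, f.comm, Category.assoc, g.comm,
    Category.assoc]⟩

@[ext]
theorem hom_ext {M N : DiffMod R} {f g : M ⟶ N} (h : f.hom = g.hom) : f = g := Hom.ext h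

@[simp] theorem id_hom (M : DiffMod R) : Hom.hom (𝟙 M) = 𝟙 M.carrier := rfl

@[simp] theorem comp_hom {L M N : DiffMod R} (f : L ⟶ M) (g : M ⟶ N) :
    (f ≫ g).hom = f.hom ≫ g.hom := rfl

section Additive

variable {M N : DiffMod R}

instance : Zero (M ⟶ N) := ⟨⟨0, by simp⟩⟩
instance : Add (M ⟶ N) := ⟨fun f g => ⟨f.hom + g.hom, by simp [f.comm, g.comm]⟩⟩
instance : Neg (M ⟶ N) := ⟨fun f => ⟨-f.hom, by simp [f.comm]⟩⟩
instance : Sub (M ⟶ N) := ⟨fun f g => ⟨f.hom - g.hom, by simp [f.comm, g.comm]⟩⟩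
instance : SMul ℕ (M ⟶ N) := ⟨fun n f => ⟨n • f.hom, by simp [f.comm]⟩⟩
instance : SMul ℤ (M ⟶ N) := ⟨fun n f => ⟨n • f.hom, by simp [f.comm]⟩⟩

theorem hom_injective : Function.Injective (fun f : M ⟶ N => f.hom) := fun _ _ h => hom_ext h

instance : AddCommGroup (M ⟶ N) :=
  hom_injective.addCommGroup _ rfl (fun _ _ => rfl) (fun _ => rfl) (fun _ _ => rfl)
    (fun _ _ => rfl) (fun _ _ => rfl)

@[simp] theorem zero_hom : Hom.hom (0 : M ⟶ N) = 0 := rfl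
@[simp] theorem add_hom (f g : M ⟶ N) : (f + g).hom = f.hom + g.hom := rfl
@[simp] theorem neg_hom (f : M ⟶ N) : (-f).hom = -f.hom := rfl
@[simp] theorem sub_hom (f g : M ⟶ N) : (f - g).hom = f.hom - g.hom := rfl

/-- Taking the underlying module map, as an additive map. -/
def homAddHom : (M ⟶ N) →+ (M.carrier ⟶ N.carrier) where
  toFun f := f.hom
  map_zero' := rfl
  map_add' _ _ := rfl

end Additive

instance : Preadditive (DiffMod R) where

section Linear

variable {k : Type u} [Field k] [Algebra k R]

instance {M N : DiffMod R} : SMul k (M ⟶ N) := ⟨fun c f => ⟨c • f.hom, by simp [f.comm]⟩⟩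

@[simp] theorem smul_hom {M N : DiffMod R} (c : k) (f : M ⟶ N) : (c • f).hom = c • f.hom := rfl

/-- Over a `k`-algebra, differential module maps form `k`-vector spaces. -/
instance : Linear k (DiffMod R) where
  homModule _ _ := hom_injective.module k homAddHom (fun _ _ => rfl)

end Linear

/-- A differential module map `f : (M, d) → (N, δ)` is null homotopic if `f = r d + δ r` for some
`R`-module map `r : M → N`. -/
def NullHomotopic {M N : DiffMod R} (f : M ⟶ N) : Prop :=
  ∃ r : M.carrier ⟶ N.carrier, f.hom = M.d ≫ r + r ≫ N.d

/-- A differential module is contractible if its identity map is null homotopic. -/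
def IsContractible (M : DiffMod R) : Prop := NullHomotopic (𝟙 M)

/-- A submodule stable under the differential, as a differential module. -/
def sub (M : DiffMod R) (A : Submodule R M.carrier) (hA : ∀ x ∈ A, M.d x ∈ A) : DiffMod R where
  carrier := ModuleCat.of R A
  d := ModuleCat.ofHom (M.d.hom.restrict hA)
  d_sq := by
    ext x
    exact congrArg (fun f : M.carrier ⟶ M.carrier => f x.1) M.d_sq

/-- A differential module `M` is reduced if it has no nonzero contractible direct summand: whenever
`M = A ⊕ B` with differential submodules `A`, `B` and `A` is contractible, then `A = 0`. -/
def IsReduced (M : DiffMod R) : Prop :=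
  ∀ (A B : Submodule R M.carrier) (hA : ∀ x ∈ A, M.d x ∈ A) (_ : ∀ x ∈ B, M.d x ∈ B),
    IsCompl A B → (M.sub A hA).IsContractible → A = ⊥

/-- The shift `Σ(M, d) = (M, -d)`. -/
def shift (M : DiffMod R) : DiffMod R where
  carrier := M.carrier
  d := -M.d
  d_sq := by simp [M.d_sq]

theorem IsReduced.shift {M : DiffMod R} (hM : M.IsReduced) : M.shift.IsReduced := by
  intro A B hA hB hAB ⟨r, hr⟩
  have h (C : Submodule R M.carrier) (hC : ∀ x ∈ C, M.shift.d x ∈ C) : ∀ x ∈ C, M.d x ∈ C :=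
    fun x hx => by
      have h' : -(-(M.d.hom x)) ∈ C := C.neg_mem (hC x hx)
      rwa [neg_neg] at h'
  refine hM A B (h A hA) (h B hB) hAB ⟨-r, ?_⟩
  have key {X : ModuleCat.{u} R} (d r : X ⟶ X) : (-d) ≫ r + r ≫ (-d) = d ≫ (-r) + (-r) ≫ d := by
    simp
  exact Eq.trans hr (key (M.sub A (h A hA)).d r)

variable (R)

/-- The differential projective `R`-modules, i.e. the differential modules whose underlying
`R`-module is projective. -/
def projective : ObjectProperty (DiffMod R) := fun M => Module.Projective R M.carrier

/-- The reduced differential projective `R`-modules. -/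
def reducedProjective : ObjectProperty (DiffMod R) := fun M =>
  Module.Projective R M.carrier ∧ M.IsReduced

theorem reducedProjective_le : reducedProjective R ≤ projective R := fun _ h => h.1

end DiffMod

variable (R : Type u) [Ring R]

/-- The category `Diff(R-Proj)` of differential projective `R`-modules. -/
abbrev DiffProj := (DiffMod.projective R).FullSubcategory

/-- The category `Diff₀(R-Proj)` of reduced differential projective `R`-modules. -/
abbrev ReducedDiffProj := (DiffMod.reducedProjective R).FullSubcategory

namespace ReducedDiffProj

variable {R}

/-- The shift of a reduced differential projective module. -/
def shift (M : ReducedDiffProj R) : ReducedDiffProj R :=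
  ⟨M.obj.shift, M.property.1, M.property.2.shift⟩

/-- The inclusion of `Diff₀(R-Proj)` in `Diff(R-Proj)`. -/
abbrev incl : ReducedDiffProj R ⥤ DiffProj R :=
  ObjectProperty.ιOfLE (DiffMod.reducedProjective_le R)

end ReducedDiffProj

namespace DiffProj

/-- Two maps of differential projective modules are homotopic if their difference is null
homotopic. -/
def homotopic : HomRel (DiffProj R) := fun _ _ f g => DiffMod.NullHomotopic (f.hom - g.hom)

instance : Congruence (homotopic R) where
  equivalence {M N} :=
    { refl := fun f => ⟨0, by simp⟩
      symm := by
        rintro f g ⟨r, hr⟩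
        refine ⟨-r, ?_⟩
        simp only [DiffMod.sub_hom] at hr ⊢
        rw [← neg_sub, hr]
        simp [add_comm]
      trans := by
        rintro f g h ⟨r, hr⟩ ⟨s, hs⟩
        refine ⟨r + s, ?_⟩
        simp only [DiffMod.sub_hom] at hr hs ⊢
        rw [← sub_add_sub_cancel _ g.hom.hom, hr, hs]
        simp only [Preadditive.comp_add, Preadditive.add_comp]
        abel }
  comp_left {L M N} f g g' := by
    rintro ⟨r, hr⟩
    refine ⟨f.hom.hom ≫ r, ?_⟩
    simp only [DiffMod.sub_hom, ObjectProperty.FullSubcategory.comp_hom, DiffMod.comp_hom] at hr ⊢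
    rw [← Preadditive.comp_sub, hr, Preadditive.comp_add, ← Category.assoc, ← f.hom.comm,
      Category.assoc, Category.assoc]
  comp_right {L M N} f f' g := by
    rintro ⟨r, hr⟩
    refine ⟨r ≫ g.hom.hom, ?_⟩
    simp only [DiffMod.sub_hom, ObjectProperty.FullSubcategory.comp_hom, DiffMod.comp_hom] at hr ⊢
    rw [← Preadditive.sub_comp, hr, Preadditive.add_comp, Category.assoc, Category.assoc,
      g.hom.comm, Category.assoc]

theorem homotopic_add ⦃M N : DiffProj R⦄ (f₁ f₂ g₁ g₂ : M ⟶ N) (hf : homotopic R f₁ f₂)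
    (hg : homotopic R g₁ g₂) : homotopic R (f₁ + g₁) (f₂ + g₂) := by
  obtain ⟨r, hr⟩ := hf
  obtain ⟨s, hs⟩ := hg
  refine ⟨r + s, ?_⟩
  have h : (f₁ + g₁).hom - (f₂ + g₂).hom = (f₁.hom - f₂.hom) + (g₁.hom - g₂.hom) :=
    add_sub_add_comm _ _ _ _
  rw [h, DiffMod.add_hom, hr, hs]
  simp only [Preadditive.comp_add, Preadditive.add_comp]
  abel

theorem homotopic_smul {k : Type u} [Field k] [Algebra k R] (c : k) ⦃M N : DiffProj R⦄
    (f₁ f₂ : M ⟶ N) (hf : homotopic R f₁ f₂) : homotopic R (c • f₁) (c • f₂) := by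
  obtain ⟨r, hr⟩ := hf
  refine ⟨c • r, ?_⟩
  have h : (c • f₁).hom - (c • f₂).hom = c • (f₁.hom - f₂.hom) := (smul_sub _ _ _).symm
  rw [h, DiffMod.smul_hom, hr, smul_add, Linear.comp_smul, Linear.smul_comp]

end DiffProj

/-- The homotopy category of differential projective `R`-modules: its objects are the differential
projective modules and its morphisms the differential module maps modulo null-homotopic maps. -/
abbrev HomotopyDiffProj := CategoryTheory.Quotient (DiffProj.homotopic R)

namespace HomotopyDiffProj

instance : Preadditive (HomotopyDiffProj R) :=
  Quotient.preadditive _ (DiffProj.homotopic_add R)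

instance : (Quotient.functor (DiffProj.homotopic R)).Additive :=
  Quotient.functor_additive _ (DiffProj.homotopic_add R)

instance {k : Type u} [Field k] [Algebra k R] : Linear k (HomotopyDiffProj R) :=
  Quotient.linear k _ (DiffProj.homotopic_smul R)

/-- The canonical functor from reduced differential projective modules to the homotopy category. -/
abbrev ofReduced : ReducedDiffProj R ⥤ HomotopyDiffProj R :=
  ReducedDiffProj.incl ⋙ Quotient.functor (DiffProj.homotopic R)

end HomotopyDiffProj

end DifferentialModules

section TopFunctor

variable {k V : Type u} [Field k] [Quiver.{u} V] [Fintype V] [∀ i j : V, Fintype (i ⟶ j)]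

/-- The functor `F` from reduced differential projective `kQ/J²`-modules to `kQᵒᵖ`-modules *is
given by taking the top*, as witnessed by identifications `e M : M / rad M ≃ F(M)`, where `rad M`
is the intersection of all maximal submodules of `M`.  This means:

* `F(f)` is the map `M / rad M → N / rad N` induced by `f`;
* the identification `e M` is `k`-linear, and `F(M)_i = (M / rad M)_i` for every vertex `i`;
* the reversed arrow `α* : j → i` of an arrow `α : i → j` acts on `F(M)` by the map
  `(M / rad M)_j → (M / rad M)_i` induced by the differential `d`.  For every `x` in `M` the element
  `d x` can be written as `∑ β y_β`, the sum being over all arrows `β`, with `y_β ∈ M`; and for each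
  such expression, `α*` sends the class of `x` to the class of `e_i y_α`, the component of `y_α` at
  the source `i` of `α`. -/
structure IsTopFunctor
    (F : ReducedDiffProj (RadSqZero k V) ⥤ ModuleCat.{u} (PathAlgebra k Vᵒᵖ))
    (e : ∀ M : ReducedDiffProj (RadSqZero k V),
      (M.obj.carrier ⧸ Module.jacobson (RadSqZero k V) M.obj.carrier) ≃+ F.obj M) : Prop where
  map_mk : ∀ {M N : ReducedDiffProj (RadSqZero k V)} (f : M ⟶ N) (x : M.obj.carrier),
    F.map f (e M (Submodule.Quotient.mk x)) = e N (Submodule.Quotient.mk (f.hom.hom x))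
  scalar : ∀ (M : ReducedDiffProj (RadSqZero k V)) (c : k)
    (x : M.obj.carrier ⧸ Module.jacobson (RadSqZero k V) M.obj.carrier),
    e M (algebraMap k (RadSqZero k V) c • x) = algebraMap k (PathAlgebra k Vᵒᵖ) c • e M x
  vertex : ∀ (M : ReducedDiffProj (RadSqZero k V)) (i : V)
    (x : M.obj.carrier ⧸ Module.jacobson (RadSqZero k V) M.obj.carrier),
    e M (RadSqZero.vertex k i • x) = PathAlgebra.vertex k (Opposite.op i) • e M x
  exists_d_eq : ∀ (M : ReducedDiffProj (RadSqZero k V)) (x : M.obj.carrier),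
    ∃ y : ∀ i j : V, (i ⟶ j) → M.obj.carrier,
      M.obj.d x = ∑ i, ∑ j, ∑ b : i ⟶ j, RadSqZero.arrow k b • y i j b
  arrow : ∀ (M : ReducedDiffProj (RadSqZero k V)) (x : M.obj.carrier)
    (y : ∀ i j : V, (i ⟶ j) → M.obj.carrier),
    M.obj.d x = ∑ i, ∑ j, ∑ b : i ⟶ j, RadSqZero.arrow k b • y i j b →
    ∀ (i j : V) (a : i ⟶ j),
      PathAlgebra.arrow k a.op • e M (Submodule.Quotient.mk x) =
        e M (Submodule.Quotient.mk (RadSqZero.vertex k i • y i j a))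

end TopFunctor

/-!
Write `Λ = kQ/J²`. The vertices span a complement of the radical of `Λ`, and the elements of `rad M`
are the sums `∑ a y_a` over the arrows. For a projective `M`, the classes of the components
`e_{s(a)} y_a` in the top `M / rad M` are well defined and determine the sum
(`ReducedDiffProj.coeff`, `ReducedDiffProj.ext_coeff`): an element of the radical is nothing but a
family of elements of the top, indexed by the arrows.

A differential projective module is reduced if and only if its differential has values in the
radical (`DiffMod.d_mem_radical`, `DiffMod.isReduced_of_forall_mem_radical`): otherwise, as the top
is semisimple, a contractible summand can be split off. So the differential is the same datum as a
family of maps of the top, one for each arrow, that is, as an action of the reversed arrows. This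
gives the functor `ReducedDiffProj.topFunctor`. Module maps between tops lift by projectivity, and
their lifts commute with the differentials exactly if the maps commute with the reversed arrows
(`ReducedDiffProj.comm_of_top_arrow`). Hence the functor is full; it is dense since the top of a
projective cover of any module over the vertices is that module (`ReducedDiffProj.diffCover`); and
it detects isomorphisms since the radical-valued endomorphisms have square zero.

A morphism is killed by the functor if and only if it is radical-valued, so the kernel of the map
from the morphisms in the homotopy category to the morphisms of tops consists of the radical-valued
maps `f : M → N` modulo the `r d + δ r`. To compare it with the extensions, let `π : P → F(M)` be a
projective presentation with kernel `K`, and `σ` a section of `π` over the vertices. A homomorphism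
`g : K → F(ΣN)` gives the radical-valued map whose coefficient at an arrow `a` is
`g (a* σ(x) - σ(a* x))` (`ReducedDiffProj.ofKernelHom`). It is null-homotopic if and only if `g`
extends to `P` (`ReducedDiffProj.ofKernelHom_eq_commutator_iff`), and every radical-valued map is
homotopic to one of this form
(`ReducedDiffProj.exists_ofKernelHom_sub_eq_commutator`). The sign in `ΣN` turns the commutators
`r d - δ r` into the null-homotopic maps `r d + δ r`. By dimension shifting, the maps `K → F(ΣN)`
modulo those which extend to `P` are `Ext¹(F(M), F(ΣN))`.
-/

/-! ### Generators and relations of the path algebra -/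

namespace PathAlgebra

section Generation

variable {k V : Type u} [Field k] [Quiver.{u} V] [Fintype V]

omit [Fintype V] in
theorem ofPath_cons {i j l : V} (p : Quiver.Path i j) (a : j ⟶ l) :
    ofPath k ⟨i, l, p.cons a⟩ = arrow k a * ofPath k ⟨i, j, p⟩ :=
  (ofPath_mul_ofPath_of_eq (QuiverPath.ofArrow a) ⟨i, j, p⟩ rfl).symm

/-- The path algebra is generated, as a `k`-algebra, by the vertices and the arrows. -/
theorem generation {P : PathAlgebra k V → Prop} (x : PathAlgebra k V)
    (scalar : ∀ c : k, P (algebraMap k _ c)) (vertex : ∀ i, P (vertex k i))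
    (arrow : ∀ (i j : V) (a : i ⟶ j), P (arrow k a))
    (add : ∀ x y, P x → P y → P (x + y)) (mul : ∀ x y, P x → P y → P (x * y)) : P x := by
  induction x using PathAlgebra.induction with
  | h0 => simpa using scalar 0
  | hadd x y hx hy => exact add x y hx hy
  | hpath c p =>
    rw [Algebra.smul_def]
    refine mul _ _ (scalar c) ?_
    obtain ⟨i, j, p⟩ := p
    induction p with
    | nil => exact vertex i
    | cons p a ih => rw [ofPath_cons]; exact mul _ _ (arrow _ _ a) ih

theorem vertex_completeOrthogonalIdempotents :
    CompleteOrthogonalIdempotents (vertex k : V → PathAlgebra k V) where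
  idem i := by
    classical exact (vertex_mul_ofPath i (QuiverPath.trivial i)).trans (if_pos rfl)
  ortho i j h := by
    classical exact (vertex_mul_ofPath i (QuiverPath.trivial j)).trans (if_neg h.symm)
  complete := rfl

omit [Fintype V] in
theorem vertex_mul_arrow {i j : V} (a : i ⟶ j) : vertex k j * arrow k a = arrow k a := by
  classical exact (vertex_mul_ofPath j (QuiverPath.ofArrow a)).trans (if_pos rfl)

omit [Fintype V] in
theorem arrow_mul_vertex {i j : V} (a : i ⟶ j) : arrow k a * vertex k i = arrow k a := by
  classical exact (ofPath_mul_vertex i (QuiverPath.ofArrow a)).trans (if_pos rfl)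

end Generation

section Lift

variable {k V E : Type u} [Field k] [Quiver.{u} V] [Fintype V] [Ring E] [Algebra k E]
  (ε : V → E) (α : ∀ i j : V, (i ⟶ j) → E)

/-- The product, in a ring, of the elements attached to the arrows of a path; a trivial path is
sent to the element attached to its vertex. -/
def pathProd (i : V) : ∀ {j : V}, Quiver.Path i j → E
  | _, .nil => ε i
  | _, .cons p a => α _ _ a * pathProd i p

variable (hε : CompleteOrthogonalIdempotents ε)
  (hl : ∀ (i j : V) (a : i ⟶ j), ε j * α i j a = α i j a)
  (hr : ∀ (i j : V) (a : i ⟶ j), α i j a * ε i = α i j a)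

include hε hl in
theorem idem_mul_pathProd {i j : V} (p : Quiver.Path i j) :
    ε j * pathProd ε α i p = pathProd ε α i p := by
  cases p with
  | nil => exact hε.idem i
  | cons p a => rw [pathProd, ← mul_assoc, hl]

include hε in
theorem pathProd_mul_idem {i j : V} (p : Quiver.Path i j) :
    pathProd ε α i p * ε i = pathProd ε α i p := by
  induction p with
  | nil => exact hε.idem i
  | cons p a ih => rw [pathProd, mul_assoc, ih]

include hε hl in
theorem pathProd_comp {i j l : V} (p : Quiver.Path i j) (q : Quiver.Path j l) :
    pathProd ε α i (p.comp q) = pathProd ε α j q * pathProd ε α i p := by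
  induction q with
  | nil => exact (idem_mul_pathProd ε α hε hl p).symm
  | cons q a ih => rw [Quiver.Path.comp_cons, pathProd, ih, pathProd, mul_assoc]

/-- The universal property of the path algebra: a complete family of orthogonal idempotents,
indexed by the vertices, and elements attached to the arrows that are fixed on the left by the
idempotents at their targets define an algebra homomorphism. For its value at an arrow to be the
given element, that element has to be fixed on the right by the idempotent at the source as well. -/
noncomputable def liftAlg : PathAlgebra k V →ₐ[k] E :=
  AlgHom.ofLinearMap (lift fun p => pathProd ε α p.src p.path)
    (by
      rw [one_def, map_sum, ← hε.complete]
      exact Finset.sum_congr rfl fun i _ => lift_ofPath _ _)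
    (by
      intro x y
      induction x using PathAlgebra.induction with
      | h0 => simp
      | hadd x x' hx hx' => rw [add_mul, map_add, hx, hx', map_add, add_mul]
      | hpath c q =>
      rw [smul_mul_assoc, map_smul, map_smul, smul_mul_assoc]
      congr 1
      induction y using PathAlgebra.induction with
      | h0 => simp
      | hadd x x' hx hx' => rw [mul_add, map_add, hx, hx', map_add, mul_add]
      | hpath c p =>
      rw [mul_smul_comm, map_smul, map_smul, mul_smul_comm]
      congr 1
      rw [lift_ofPath, lift_ofPath]
      obtain ⟨i, j, p⟩ := p
      obtain ⟨j', l, q⟩ := q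
      by_cases h : j = j'
      · subst h
        rw [ofPath_mul_ofPath_of_eq _ _ rfl, lift_ofPath]
        exact pathProd_comp ε α hε hl p q
      · rw [ofPath_mul_ofPath_of_ne _ _ h, map_zero, ← pathProd_mul_idem ε α hε q,
          ← idem_mul_pathProd ε α hε hl p, mul_assoc, ← mul_assoc (ε j'),
          hε.ortho (Ne.symm h), zero_mul, mul_zero])

theorem liftAlg_vertex (i : V) : liftAlg (k := k) ε α hε hl (vertex k i) = ε i :=
  lift_ofPath _ _

include hr in
theorem liftAlg_arrow {i j : V} (a : i ⟶ j) : liftAlg (k := k) ε α hε hl (arrow k a) = α i j a :=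
  (lift_ofPath _ _).trans (hr i j a)

end Lift

end PathAlgebra

/-! ### The algebra with radical square zero -/

namespace PathAlgebra

variable (k : Type u) {V : Type u} [Field k] [Quiver.{u} V] [Fintype V]

open Classical in
variable (V) in
/-- The augmentation of the path algebra: the algebra homomorphism to `k^V` that reads off the
coefficients at the trivial paths. -/
noncomputable def augmentation : PathAlgebra k V →ₐ[k] (V → k) :=
  liftAlg (fun i => Pi.single i (1 : k)) (fun _ _ _ => 0)
    (CompleteOrthogonalIdempotents.single (fun _ : V => k))
    (fun _ _ _ => mul_zero _)

open Classical in
theorem augmentation_vertex (i : V) : augmentation k V (vertex k i) = Pi.single i 1 := by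
  rw [augmentation, liftAlg_vertex]

theorem augmentation_arrow {i j : V} (a : i ⟶ j) : augmentation k V (arrow k a) = 0 := by
  exact liftAlg_arrow _ _ _ _ (fun _ _ _ => zero_mul _) _

theorem arrow_mem_arrowIdeal {i j : V} (a : i ⟶ j) : arrow k a ∈ arrowIdeal k V :=
  TwoSidedIdeal.mem_asIdeal.2 (TwoSidedIdeal.subset_span ⟨i, j, a, rfl⟩)

theorem augmentation_eq_zero {x : PathAlgebra k V} (hx : x ∈ arrowIdeal k V) :
    augmentation k V x = 0 := by
  have h : TwoSidedIdeal.span {x : PathAlgebra k V | ∃ (i j : V) (a : i ⟶ j), x = arrow k a} ≤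
      TwoSidedIdeal.ker (augmentation k V) := by
    rw [TwoSidedIdeal.span_le]
    rintro _ ⟨i, j, a, rfl⟩
    exact (TwoSidedIdeal.mem_ker _).2 (augmentation_arrow k a)
  exact (TwoSidedIdeal.mem_ker _).1 (h (TwoSidedIdeal.mem_asIdeal.1 hx))

theorem eq_zero_of_mem_arrowIdeal_sq {E : Type u} [Ring E] [Algebra k E]
    (φ : PathAlgebra k V →ₐ[k] E)
    (h : ∀ x y, augmentation k V x = 0 → augmentation k V y = 0 → φ x * φ y = 0)
    {x : PathAlgebra k V} (hx : x ∈ arrowIdeal k V ^ 2) : φ x = 0 := by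
  have hle : arrowIdeal k V ^ 2 ≤ RingHom.ker φ := by
    rw [Submodule.pow_succ, Submodule.pow_one]
    refine Ideal.mul_le.2 fun r hr s hs => ?_
    rw [RingHom.mem_ker, map_mul]
    exact h r s (augmentation_eq_zero k hr) (augmentation_eq_zero k hs)
  exact hle hx

open Classical in
/-- For an arrow `a : i ⟶ j`, the representation of the path algebra by lower triangular `2 × 2`
matrices whose diagonal entries are the coefficients of the trivial paths `e_i` and `e_j` and whose
lower left entry is the coefficient of `a`. -/
noncomputable def arrowRep {i j : V} (a : i ⟶ j) :
    PathAlgebra k V →ₐ[k] Matrix (Fin 2) (Fin 2) k :=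
  liftAlg
    (fun l => Matrix.diagonal ![(Pi.single l (1 : k) : V → k) i, (Pi.single l (1 : k) : V → k) j])
    (fun i' j' b => !![0, 0;
      if (⟨i', j', b⟩ : Σ i j : V, (i ⟶ j)) = ⟨i, j, a⟩ then 1 else 0, 0])
    { idem := fun l => by
        simp only [IsIdempotentElem, Matrix.diagonal_mul_diagonal]
        congr 1
        ext t
        fin_cases t <;> simp [Pi.single_apply]
      ortho := fun l m h => by
        simp only [Matrix.diagonal_mul_diagonal]
        rw [← Matrix.diagonal_zero]
        congr 1
        ext t
        have h' (n : V) :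
            (Pi.single l (1 : k) : V → k) n * (Pi.single m (1 : k) : V → k) n = 0 := by
          rw [← Pi.mul_apply, ← Pi.single_mul_left]
          simp [Pi.single_apply, h]
        fin_cases t <;> simp [h']
      complete := by
        rw [← Matrix.diagonal_one]
        ext s t
        fin_cases s <;> fin_cases t <;> simp [Matrix.sum_apply, Pi.single_apply] }
    (fun i' j' b => by
      split_ifs with h
      · cases h
        ext s t
        fin_cases s <;> fin_cases t <;> simp
      · ext s t
        fin_cases s <;> fin_cases t <;> simp)

open Classical in
theorem arrowRep_arrow {i j i' j' : V} (a : i ⟶ j) (b : i' ⟶ j') :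
    arrowRep k a (arrow k b) =
      !![0, 0; if (⟨i', j', b⟩ : Σ i j : V, (i ⟶ j)) = ⟨i, j, a⟩ then 1 else 0, 0] := by
  refine liftAlg_arrow _ _ _ _ (fun i' j' b => ?_) _
  split_ifs with h
  · cases h
    ext s t
    fin_cases s <;> fin_cases t <;> simp
  · ext s t
    fin_cases s <;> fin_cases t <;> simp

theorem arrowRep_triangular {i j : V} (a : i ⟶ j) (x : PathAlgebra k V) :
    arrowRep k a x 0 0 = augmentation k V x i ∧ arrowRep k a x 1 1 = augmentation k V x j ∧
      arrowRep k a x 0 1 = 0 := by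
  classical
  induction x using generation with
  | scalar c => simp [AlgHom.commutes, Matrix.algebraMap_matrix_apply]
  | vertex l =>
    rw [arrowRep, liftAlg_vertex, augmentation_vertex]
    simp
  | arrow i' j' b =>
    rw [arrowRep_arrow, augmentation_arrow]
    simp
  | add x y hx hy => simp [hx, hy]
  | mul x y hx hy => simp [hx, hy, Matrix.mul_apply]

end PathAlgebra

namespace RadSqZero

variable {k V : Type u} [Field k] [Quiver.{u} V] [Fintype V]

variable (k V) in
/-- The augmentation `kQ/J² → k^V`, whose kernel is the radical. -/
noncomputable def augmentation : RadSqZero k V →ₐ[k] (V → k) :=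
  Ideal.Quotient.liftₐ _ (PathAlgebra.augmentation k V) fun _ hx =>
    PathAlgebra.eq_zero_of_mem_arrowIdeal_sq k _ (fun x y hx _ => by rw [hx, zero_mul]) hx

open Classical in
theorem augmentation_vertex (i : V) : augmentation k V (vertex k i) = Pi.single i 1 :=
  PathAlgebra.augmentation_vertex k i

theorem augmentation_arrow {i j : V} (a : i ⟶ j) : augmentation k V (arrow k a) = 0 :=
  PathAlgebra.augmentation_arrow k a

/-- The representation of `kQ/J²` by lower triangular matrices attached to an arrow. -/
noncomputable def arrowRep {i j : V} (a : i ⟶ j) :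
    RadSqZero k V →ₐ[k] Matrix (Fin 2) (Fin 2) k :=
  Ideal.Quotient.liftₐ _ (PathAlgebra.arrowRep k a) fun _ hx =>
    PathAlgebra.eq_zero_of_mem_arrowIdeal_sq k _ (fun x y hx hy => by
      obtain ⟨hx0, hx1, hx2⟩ := PathAlgebra.arrowRep_triangular k a x
      obtain ⟨hy0, hy1, hy2⟩ := PathAlgebra.arrowRep_triangular k a y
      rw [hx] at hx0 hx1
      rw [hy] at hy0 hy1
      ext s t
      fin_cases s <;> fin_cases t <;> simp [Matrix.mul_apply, *]) hx

theorem arrowRep_zero_zero {i j : V} (a : i ⟶ j) (x : RadSqZero k V) :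
    arrowRep a x 0 0 = augmentation k V x i := by
  obtain ⟨x, rfl⟩ := Ideal.Quotient.mk_surjective x
  exact (PathAlgebra.arrowRep_triangular k a x).1

open Classical in
theorem arrowRep_arrow {i j i' j' : V} (a : i ⟶ j) (b : i' ⟶ j') :
    arrowRep a (arrow k b) =
      !![0, 0; if (⟨i', j', b⟩ : Σ i j : V, (i ⟶ j)) = ⟨i, j, a⟩ then 1 else 0, 0] :=
  PathAlgebra.arrowRep_arrow k a b

theorem arrow_mul_arrow {i j i' j' : V} (a : i ⟶ j) (b : i' ⟶ j') :
    arrow k a * arrow k b = 0 := by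
  rw [arrow, arrow, ← map_mul]
  refine Ideal.Quotient.eq_zero_iff_mem.2 ?_
  rw [Submodule.pow_succ, Submodule.pow_one]
  exact Ideal.mul_mem_mul (PathAlgebra.arrow_mem_arrowIdeal k a)
    (PathAlgebra.arrow_mem_arrowIdeal k b)

theorem vertex_completeOrthogonalIdempotents :
    CompleteOrthogonalIdempotents (vertex k : V → RadSqZero k V) :=
  PathAlgebra.vertex_completeOrthogonalIdempotents.map
    (Ideal.Quotient.mk ((PathAlgebra.arrowIdeal k V) ^ 2))

theorem vertex_mul_arrow {i j : V} (a : i ⟶ j) : vertex k j * arrow k a = arrow k a :=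
  congrArg (Ideal.Quotient.mk _) (PathAlgebra.vertex_mul_arrow a)

theorem arrow_mul_vertex {i j : V} (a : i ⟶ j) : arrow k a * vertex k i = arrow k a :=
  congrArg (Ideal.Quotient.mk _) (PathAlgebra.arrow_mul_vertex a)

open Classical in
theorem vertex_mul_arrow' (l : V) {i j : V} (a : i ⟶ j) :
    vertex k l * arrow k a = (Pi.single l 1 : V → k) j • arrow k a := by
  by_cases h : l = j
  · subst h; simp [vertex_mul_arrow]
  · rw [← vertex_mul_arrow a, ← mul_assoc, vertex_completeOrthogonalIdempotents.ortho h]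
    simp [Ne.symm h]

open Classical in
theorem arrow_mul_vertex' (l : V) {i j : V} (a : i ⟶ j) :
    arrow k a * vertex k l = (Pi.single l 1 : V → k) i • arrow k a := by
  by_cases h : i = l
  · subst h; simp [arrow_mul_vertex]
  · rw [← arrow_mul_vertex a, mul_assoc, vertex_completeOrthogonalIdempotents.ortho h]
    simp [h]

section FiniteArrows

variable [∀ i j : V, Fintype (i ⟶ j)]

/-- The vertices and the arrows span `kQ/J²` over `k`. -/
theorem exists_decomposition (x : RadSqZero k V) : ∃ c : ∀ i j : V, (i ⟶ j) → k,
    x = ∑ i, augmentation k V x i • vertex k i + ∑ i, ∑ j, ∑ b : i ⟶ j, c i j b • arrow k b := by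
  classical
  obtain ⟨x, rfl⟩ := Ideal.Quotient.mk_surjective x
  induction x using PathAlgebra.induction with
  | h0 => exact ⟨0, by simp⟩
  | hadd x y hx hy =>
    obtain ⟨c, hc⟩ := hx
    obtain ⟨c', hc'⟩ := hy
    refine ⟨c + c', ?_⟩
    rw [map_add, map_add]
    conv_lhs => rw [hc, hc']
    simp only [Pi.add_apply, add_smul, Finset.sum_add_distrib]
    abel
  | hpath r p =>
    suffices h : ∃ c : ∀ i j : V, (i ⟶ j) → k,
        Ideal.Quotient.mk (PathAlgebra.arrowIdeal k V ^ 2) (PathAlgebra.ofPath k p) =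
        ∑ i, augmentation k V (Ideal.Quotient.mk (PathAlgebra.arrowIdeal k V ^ 2)
          (PathAlgebra.ofPath k p)) i • vertex k i +
        ∑ i, ∑ j, ∑ b : i ⟶ j, c i j b • arrow k b by
      obtain ⟨c, hc⟩ := h
      refine ⟨r • c, ?_⟩
      have hr : Ideal.Quotient.mk (PathAlgebra.arrowIdeal k V ^ 2) (r • PathAlgebra.ofPath k p) =
        r • Ideal.Quotient.mk (PathAlgebra.arrowIdeal k V ^ 2) (PathAlgebra.ofPath k p) := rfl
      rw [hr, map_smul]
      conv_lhs => rw [hc]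
      simp only [Pi.smul_apply, smul_add, Finset.smul_sum, smul_assoc]
    obtain ⟨i, j, p⟩ := p
    cases p with
    | nil =>
      refine ⟨0, ?_⟩
      have h : Ideal.Quotient.mk (PathAlgebra.arrowIdeal k V ^ 2)
        (PathAlgebra.ofPath k ⟨i, i, Quiver.Path.nil⟩) = vertex k i := rfl
      rw [h, augmentation_vertex]
      simp [Pi.single_apply]
    | cons p a =>
      cases p with
      | nil =>
        refine ⟨fun i' j' b => if (⟨i', j', b⟩ : Σ i j : V, (i ⟶ j)) = ⟨_, _, a⟩ then 1 else 0, ?_⟩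
        have h : Ideal.Quotient.mk (PathAlgebra.arrowIdeal k V ^ 2)
          (PathAlgebra.ofPath k ⟨_, _, Quiver.Path.nil.cons a⟩) = arrow k a := rfl
        rw [h, augmentation_arrow]
        have hs (f : (Σ i j : V, (i ⟶ j)) → RadSqZero k V) :
            ∑ i, ∑ j, ∑ b : i ⟶ j, f ⟨i, j, b⟩ = ∑ b, f b := by
          simp only [Fintype.sum_sigma]
        rw [hs fun b => (if b = ⟨_, _, a⟩ then (1 : k) else 0) • arrow k b.2.2]
        simp
      | cons p b =>
        refine ⟨0, ?_⟩
        have h : Ideal.Quotient.mk (PathAlgebra.arrowIdeal k V ^ 2)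
          (PathAlgebra.ofPath k ⟨_, _, (p.cons b).cons a⟩) = 0 := by
          rw [PathAlgebra.ofPath_cons, PathAlgebra.ofPath_cons, ← mul_assoc, map_mul, map_mul]
          exact (congrArg (· * _) (arrow_mul_arrow a b)).trans (zero_mul _)
        rw [h]
        simp

theorem mul_arrow (x : RadSqZero k V) {i j : V} (a : i ⟶ j) :
    x * arrow k a = augmentation k V x j • arrow k a := by
  classical
  obtain ⟨c, hc⟩ := exists_decomposition x
  conv_lhs => rw [hc]
  simp [add_mul, Finset.sum_mul, arrow_mul_arrow, vertex_mul_arrow', Pi.single_apply]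

theorem arrow_mul (x : RadSqZero k V) {i j : V} (a : i ⟶ j) :
    arrow k a * x = augmentation k V x i • arrow k a := by
  classical
  obtain ⟨c, hc⟩ := exists_decomposition x
  conv_lhs => rw [hc]
  simp [mul_add, Finset.mul_sum, arrow_mul_arrow, arrow_mul_vertex', Pi.single_apply]

/-- The arrows are linearly independent from the right: in a relation `∑ b λ_b = 0`, the coefficient
of `λ_a` at the source of `a` vanishes. -/
theorem augmentation_eq_zero_of_sum_eq_zero (y : ∀ i j : V, (i ⟶ j) → RadSqZero k V)
    (h : ∑ i, ∑ j, ∑ b : i ⟶ j, arrow k b * y i j b = 0) {i j : V} (a : i ⟶ j) :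
    augmentation k V (y i j a) i = 0 := by
  classical
  have h1 := congrArg (fun x => arrowRep a x 1 0) h
  have hs (f : (Σ i j : V, (i ⟶ j)) → k) :
      ∑ i, ∑ j, ∑ b : i ⟶ j, f ⟨i, j, b⟩ = ∑ b, f b := by
    simp only [Fintype.sum_sigma]
  simp only [map_sum, map_mul, Matrix.sum_apply, arrowRep_arrow, Matrix.mul_apply, map_zero,
    Fin.sum_univ_two] at h1
  rw [hs fun b => (!![0, 0; if b = ⟨i, j, a⟩ then 1 else 0, 0] : Matrix (Fin 2) (Fin 2) k) 1 0 *
      (arrowRep a (y b.1 b.2.1 b.2.2)) 0 0 +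
    (!![0, 0; if b = ⟨i, j, a⟩ then 1 else 0, 0] : Matrix (Fin 2) (Fin 2) k) 1 1 *
      (arrowRep a (y b.1 b.2.1 b.2.2)) 1 0] at h1
  simpa [arrowRep_zero_zero] using h1

end FiniteArrows

end RadSqZero

/-! ### The radical of a module over the algebra with radical square zero -/

section IdempotentHom

variable {k V E : Type*} [Field k] [Fintype V] [Ring E] [Algebra k E] {ε : V → E}

/-- The algebra homomorphism from `k^V` given by a complete family of orthogonal idempotents. -/
noncomputable def CompleteOrthogonalIdempotents.algHom (hε : CompleteOrthogonalIdempotents ε) :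
    (V → k) →ₐ[k] E :=
  AlgHom.ofLinearMap (∑ i, (LinearMap.proj i).smulRight (ε i))
    (by simp [hε.complete])
    (by
      classical
      intro x y
      simp [Finset.sum_mul, Finset.mul_sum, smul_smul, hε.mul_eq, mul_comm])

theorem CompleteOrthogonalIdempotents.algHom_apply (hε : CompleteOrthogonalIdempotents ε)
    (c : V → k) : hε.algHom c = ∑ i, c i • ε i := by
  simp [CompleteOrthogonalIdempotents.algHom]

end IdempotentHom

namespace RadSqZero

variable {k V : Type u} [Field k] [Quiver.{u} V] [Fintype V] [∀ i j : V, Fintype (i ⟶ j)]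
  {M N : Type*} [AddCommGroup M] [Module (RadSqZero k V) M]
  [AddCommGroup N] [Module (RadSqZero k V) N]

theorem smul_arrow_smul (x : RadSqZero k V) {i j : V} (a : i ⟶ j) (m : M) :
    x • arrow k a • m =
      arrow k a • algebraMap k (RadSqZero k V) (augmentation k V x j) • m := by
  rw [← mul_smul, mul_arrow, Algebra.smul_def, Algebra.commutes, mul_smul]

omit [∀ i j : V, Fintype (i ⟶ j)] in
theorem arrow_smul_vertex_smul {i j : V} (a : i ⟶ j) (m : M) :
    arrow k a • vertex k i • m = arrow k a • m := by
  rw [← mul_smul, arrow_mul_vertex]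

/-- The linear combination `∑ b y_b` over all arrows `b`. -/
noncomputable def arrowSum : (∀ i j : V, (i ⟶ j) → M) →+ M where
  toFun y := ∑ i, ∑ j, ∑ b : i ⟶ j, arrow k b • y i j b
  map_zero' := by simp
  map_add' y z := by simp [Finset.sum_add_distrib]

theorem arrowSum_apply (y : ∀ i j : V, (i ⟶ j) → M) :
    arrowSum (k := k) y = ∑ i, ∑ j, ∑ b : i ⟶ j, arrow k b • y i j b := rfl

theorem map_arrowSum (f : M →ₗ[RadSqZero k V] N) (y : ∀ i j : V, (i ⟶ j) → M) :
    f (arrowSum (k := k) y) = arrowSum (k := k) fun i j b => f (y i j b) := by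
  simp [arrowSum_apply]

theorem smul_arrowSum (x : RadSqZero k V) (y : ∀ i j : V, (i ⟶ j) → M) :
    x • arrowSum (k := k) y = arrowSum (k := k) fun i j b =>
      algebraMap k (RadSqZero k V) (augmentation k V x j) • y i j b := by
  simp [arrowSum_apply, Finset.smul_sum, smul_arrow_smul]

open Classical in
/-- The family of elements indexed by the arrows that vanishes away from a single arrow. -/
noncomputable def singleArrow {i j : V} (a : i ⟶ j) (m : M) : ∀ i j : V, (i ⟶ j) → M :=
  fun i' j' b => if (⟨i', j', b⟩ : Σ i j : V, (i ⟶ j)) = ⟨i, j, a⟩ then m else 0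

theorem arrowSum_singleArrow {i j : V} (a : i ⟶ j) (m : M) :
    arrowSum (k := k) (singleArrow a m) = arrow k a • m := by
  classical
  have hs (f : (Σ i j : V, (i ⟶ j)) → M) :
      ∑ i, ∑ j, ∑ b : i ⟶ j, f ⟨i, j, b⟩ = ∑ b, f b := by
    simp only [Fintype.sum_sigma]
  rw [arrowSum_apply]
  refine (hs fun b => arrow k b.2.2 • if b = ⟨i, j, a⟩ then m else 0).trans ?_
  simp

variable (k V M) in
/-- The radical of a module over `kQ/J²`: the submodule of all sums `∑ b y_b` over the arrows `b`.
It agrees with the intersection of the maximal submodules, see `jacobson_eq_radical`. -/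
noncomputable def radical : Submodule (RadSqZero k V) M where
  __ := AddMonoidHom.range (arrowSum (k := k) (V := V) (M := M))
  smul_mem' := by
    rintro x _ ⟨y, rfl⟩
    exact ⟨_, (smul_arrowSum x y).symm⟩

theorem mem_radical {x : M} : x ∈ radical k V M ↔ ∃ y, x = arrowSum (k := k) (V := V) y :=
  ⟨fun ⟨y, h⟩ => ⟨y, h.symm⟩, fun ⟨y, h⟩ => ⟨y, h.symm⟩⟩

theorem arrow_smul_mem_radical {i j : V} (a : i ⟶ j) (m : M) : arrow k a • m ∈ radical k V M :=
  mem_radical.2 ⟨_, (arrowSum_singleArrow a m).symm⟩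

theorem arrow_smul_of_mem_radical {i j : V} (a : i ⟶ j) {m : M} (hm : m ∈ radical k V M) :
    arrow k a • m = 0 := by
  obtain ⟨y, rfl⟩ := mem_radical.1 hm
  simp [arrowSum_apply, Finset.smul_sum, ← mul_smul, arrow_mul_arrow]

theorem map_mem_radical (f : M →ₗ[RadSqZero k V] N) {m : M} (hm : m ∈ radical k V M) :
    f m ∈ radical k V N := by
  obtain ⟨y, rfl⟩ := mem_radical.1 hm
  exact mem_radical.2 ⟨_, map_arrowSum f y⟩

/-- A module homomorphism into the radical kills the radical. -/
theorem eq_zero_of_forall_mem_radical (f : M →ₗ[RadSqZero k V] N)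
    (hf : ∀ m, f m ∈ radical k V N) {m : M} (hm : m ∈ radical k V M) : f m = 0 := by
  obtain ⟨y, rfl⟩ := mem_radical.1 hm
  rw [map_arrowSum]
  simp [arrowSum_apply, arrow_smul_of_mem_radical _ (hf _)]

/-- The section of the augmentation given by the vertices. -/
noncomputable def vertexHom : (V → k) →ₐ[k] RadSqZero k V :=
  vertex_completeOrthogonalIdempotents.algHom

omit [∀ i j : V, Fintype (i ⟶ j)] in
theorem augmentation_vertexHom (c : V → k) : augmentation k V (vertexHom c) = c := by
  classical
  ext i
  simp [vertexHom, CompleteOrthogonalIdempotents.algHom_apply, augmentation_vertex,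
    Pi.single_apply]

theorem smul_sub_smul_mem_radical (x : RadSqZero k V) (m : M) :
    x • m - vertexHom (augmentation k V x) • m ∈ radical k V M := by
  obtain ⟨c, hc⟩ := exists_decomposition x
  rw [vertexHom, CompleteOrthogonalIdempotents.algHom_apply]
  rw [← sub_smul]
  nth_rw 1 [hc]
  rw [add_sub_cancel_left]
  simp only [Finset.sum_smul, Algebra.smul_def, mul_smul]
  exact Submodule.sum_mem _ fun i _ => Submodule.sum_mem _ fun j _ => Submodule.sum_mem _
    fun b _ => Submodule.smul_mem _ _ (arrow_smul_mem_radical b m)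

theorem smul_mem_radical {x : RadSqZero k V} (hx : augmentation k V x = 0) (m : M) :
    x • m ∈ radical k V M := by
  simpa [hx] using smul_sub_smul_mem_radical x m

variable (k V M) in
/-- A module over `kQ/J²` is semisimple modulo its radical. -/
theorem isSemisimpleModule_quotient_radical :
    IsSemisimpleModule (RadSqZero k V) (M ⧸ radical k V M) := by
  let : Module (V → k) (M ⧸ radical k V M) :=
    Module.compHom _ (vertexHom (k := k) (V := V)).toRingHom
  -- the identity is semilinear with respect to the augmentation
  let φ : (M ⧸ radical k V M) →ₛₗ[(augmentation k V).toRingHom] (M ⧸ radical k V M) :=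
    { toFun := id
      map_add' := fun _ _ => rfl
      map_smul' := fun x m => by
        obtain ⟨m, rfl⟩ := Submodule.Quotient.mk_surjective _ m
        exact (Submodule.Quotient.eq _).2 (smul_sub_smul_mem_radical x m) }
  have : RingHomSurjective (augmentation k V).toRingHom :=
    ⟨fun c => ⟨vertexHom c, augmentation_vertexHom c⟩⟩
  exact (LinearMap.isSemisimpleModule_iff_of_bijective φ Function.bijective_id).2 inferInstance

theorem arrow_mem_jacobson {i j : V} (a : i ⟶ j) :
    arrow k a ∈ Ring.jacobson (RadSqZero k V) := by
  rw [Ring.jacobson_eq_sInf_isMaximal]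
  refine Submodule.mem_sInf.2 fun (I : Ideal _) (hI : I.IsMaximal) => ?_
  by_contra ha
  -- otherwise `1 = x + y a` with `x ∈ I`; multiplying by `a` on the left gives `a = a x ∈ I`
  obtain ⟨y, x, hx, h⟩ := hI.exists_inv ha
  refine ha ?_
  have h1 : arrow k a = arrow k a * x := by
    conv_lhs => rw [← mul_one (arrow k a), ← h, mul_add, ← mul_assoc, arrow_mul,
      smul_mul_assoc, arrow_mul_arrow, smul_zero, zero_add]
  rw [h1]
  exact I.mul_mem_left _ hx

variable (k V M) in
theorem jacobson_eq_radical : Module.jacobson (RadSqZero k V) M = radical k V M := by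
  refine le_antisymm ?_ fun x hx => ?_
  · have := isSemisimpleModule_quotient_radical k V M
    exact Module.jacobson_le_of_eq_bot (IsSemisimpleModule.jacobson_eq_bot _ _)
  · obtain ⟨y, rfl⟩ := mem_radical.1 hx
    exact Submodule.sum_mem _ fun i _ => Submodule.sum_mem _ fun j _ => Submodule.sum_mem _
      fun b _ => Ring.jacobson_smul_top_le _ _
        (Submodule.smul_mem_smul (arrow_mem_jacobson b) Submodule.mem_top)

/-- In a projective module, the coefficients of a linear combination of the arrows are determined
at the sources of the arrows up to the radical. -/
theorem vertex_smul_mem_radical_of_arrowSum_eq_zero [Module.Projective (RadSqZero k V) M]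
    {y : ∀ i j : V, (i ⟶ j) → M} (h : arrowSum (k := k) y = 0) {i j : V} (a : i ⟶ j) :
    vertex k i • y i j a ∈ radical k V M := by
  classical
  obtain ⟨s, hs⟩ := Module.Projective.out (R := RadSqZero k V) (P := M)
  rw [← hs (vertex k i • y i j a), Finsupp.linearCombination_apply]
  refine Submodule.sum_mem _ fun m _ => smul_mem_radical ?_ _
  rw [map_smul, Finsupp.smul_apply, smul_eq_mul, map_mul, augmentation_vertex]
  -- the relation holds for each coordinate of the section `s`
  have h1 : arrowSum (k := k) (fun i j b => s (y i j b) m) = 0 := by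
    have := congrArg (fun z => s z m) h
    simpa [map_arrowSum, arrowSum_apply] using this
  have h2 := augmentation_eq_zero_of_sum_eq_zero _ h1 a
  ext l
  by_cases hl : l = i
  · subst hl; simpa using h2
  · simp [hl]

theorem arrow_smul_eq_zero_iff [Module.Projective (RadSqZero k V) M] {i j : V} (a : i ⟶ j)
    {m : M} : arrow k a • m = 0 ↔ vertex k i • m ∈ radical k V M := by
  refine ⟨fun h => ?_, fun h => ?_⟩
  · rw [← arrowSum_singleArrow] at h
    simpa [singleArrow] using vertex_smul_mem_radical_of_arrowSum_eq_zero h a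
  · rw [← arrow_smul_vertex_smul, arrow_smul_of_mem_radical a h]

end RadSqZero

/-! ### Reduced differential projective modules -/

namespace RadSqZero

variable {k V : Type u} [Field k] [Quiver.{u} V] [Fintype V] [∀ i j : V, Fintype (i ⟶ j)]

section Lift

variable {M N : Type*} [AddCommGroup M] [Module (RadSqZero k V) M]
  [AddCommGroup N] [Module (RadSqZero k V) N]

theorem exists_lift [Module.Projective (RadSqZero k V) M]
    (g : (M ⧸ radical k V M) →ₗ[RadSqZero k V] (N ⧸ radical k V N)) :
    ∃ f : M →ₗ[RadSqZero k V] N, ∀ m,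
      (Submodule.Quotient.mk (f m) : N ⧸ radical k V N) = g (Submodule.Quotient.mk m) := by
  obtain ⟨f, hf⟩ := Module.projective_lifting_property (radical k V N).mkQ
    (g ∘ₗ (radical k V M).mkQ) (radical k V N).mkQ_surjective
  exact ⟨f, fun m => LinearMap.congr_fun hf m⟩

end Lift

end RadSqZero

/-- An endomorphism `d` with `d² = 0` of a semisimple module has a generalized inverse `h` with
`h² = 0`. -/
theorem IsSemisimpleModule.exists_generalizedInverse {R T : Type*} [Ring R] [AddCommGroup T]
    [Module R T] [IsSemisimpleModule R T] (d : Module.End R T) (hd : d * d = 0) :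
    ∃ h : Module.End R T, d * h * d = d ∧ h * h = 0 := by
  obtain ⟨s, hs⟩ := IsSemisimpleModule.lifting_property d.rangeRestrict
    d.surjective_rangeRestrict LinearMap.id
  obtain ⟨g, hg⟩ := IsSemisimpleModule.extension_property (LinearMap.range d).subtype
    (Submodule.subtype_injective _) s
  have h1 : d * g * d = d := by
    ext x
    have h2 : g (d x) = s ⟨d x, x, rfl⟩ :=
      LinearMap.congr_fun hg (⟨d x, x, rfl⟩ : LinearMap.range d)
    have h3 : d (s ⟨d x, x, rfl⟩) = d x :=
      congrArg Subtype.val (LinearMap.congr_fun hs (⟨d x, x, rfl⟩ : LinearMap.range d))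
    simp [Module.End.mul_apply, h2, h3]
  -- `g (d g) (1 - g d)` is still a generalized inverse since `d² = 0`, and its square contains the
  -- factor `g d - g (d g d) = 0`
  have h2 : d * (g * (d * g * (1 - g * d))) * d = d := by
    have : d * (g * (d * g * (1 - g * d))) * d =
        (d * g * d) * g * d - (d * g * d) * g * g * (d * d) := by
      noncomm_ring
    rw [this, hd, mul_zero, sub_zero, h1, h1]
  refine ⟨g * (d * g * (1 - g * d)), h2, ?_⟩
  have : g * (d * g * (1 - g * d)) * (g * (d * g * (1 - g * d))) =
      g * d * g * (g * d - g * (d * g * d)) * g * (1 - g * d) := by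
    noncomm_ring
  rw [this, h1, sub_self, mul_zero, zero_mul, zero_mul]

namespace DiffMod

variable {k V : Type u} [Field k] [Quiver.{u} V] [Fintype V] [∀ i j : V, Fintype (i ⟶ j)]
  {M : DiffMod (RadSqZero k V)}

open RadSqZero

theorem d_d_apply {R : Type u} [Ring R] (M : DiffMod R) (x : M.carrier) : M.d (M.d x) = 0 :=
  congrArg (fun f : M.carrier ⟶ M.carrier => f x) M.d_sq

/-- A differential module whose differential has values in the radical is reduced: the identity of a
contractible summand is `r d + d r`, so it has values in the radical, and its square is zero. -/
theorem isReduced_of_forall_mem_radical (h : ∀ x, M.d x ∈ radical k V M.carrier) :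
    M.IsReduced := by
  rintro A B hA hB hAB ⟨r, hr⟩
  have hdA : ∀ x : A, (M.sub A hA).d x ∈ radical k V A := fun x => by
    have h1 : A.projectionOnto B hAB (M.d x.1) = (M.sub A hA).d x :=
      Submodule.projectionOnto_apply_left hAB ((M.sub A hA).d x)
    exact h1 ▸ map_mem_radical (A.projectionOnto B hAB) (h x.1)
  have hid : ∀ x : A, x = r ((M.sub A hA).d x) + (M.sub A hA).d (r x) := fun x =>
    congrArg (fun f : (M.sub A hA).carrier ⟶ (M.sub A hA).carrier => f x) hr
  have hmem : ∀ x : A, x ∈ radical k V A := fun x => by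
    rw [hid x]
    exact add_mem (map_mem_radical r.hom (hdA x)) (hdA (r x))
  refine (Submodule.eq_bot_iff _).2 fun x hx => ?_
  exact congrArg Subtype.val
    (eq_zero_of_forall_mem_radical (LinearMap.id : A →ₗ[RadSqZero k V] A) hmem (hmem ⟨x, hx⟩))

/-- The differential of a reduced differential projective module has values in the radical.
Otherwise, let `h` be the lift of a generalized inverse of the differential of the top; then
`d h + h d` is idempotent modulo the radical, and the corresponding idempotent is a null-homotopic
endomorphism of the differential module, whose range is a nonzero contractible direct summand. -/
theorem d_mem_radical (hP : Module.Projective (RadSqZero k V) M.carrier) (hM : M.IsReduced)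
    (x : M.carrier) : M.d x ∈ radical k V M.carrier := by
  have := isSemisimpleModule_quotient_radical k V M.carrier
  let d : Module.End (RadSqZero k V) M.carrier := M.d.hom
  have hd : d * d = 0 := LinearMap.ext M.d_d_apply
  -- the differential induced on the top and a generalized inverse of it
  let d' : Module.End (RadSqZero k V) (M.carrier ⧸ radical k V M.carrier) :=
    Submodule.mapQ _ _ d fun _ => map_mem_radical d
  have hd' : d' * d' = 0 := by
    ext m
    exact congrArg (Submodule.Quotient.mk) (M.d_d_apply m)
  obtain ⟨h', hh1, hh2⟩ := IsSemisimpleModule.exists_generalizedInverse d' hd'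
  obtain ⟨h, hh⟩ := exists_lift h'
  change Module.End (RadSqZero k V) M.carrier at h
  -- `t` induces an idempotent endomorphism of the top
  let t : Module.End (RadSqZero k V) M.carrier := d * h + h * d
  let t' := d' * h' + h' * d'
  have ht' : t' * t' = t' := by
    have : t' * t' = (d' * h' * d') * h' + d' * (h' * h') * d' + h' * (d' * d') * h' +
        h' * (d' * h' * d') := by
      simp only [t']; noncomm_ring
    rw [this, hh1, hh2, hd']
    simp [t']
  have htt' : ∀ m : M.carrier, (Submodule.Quotient.mk (t m) : _ ⧸ radical k V M.carrier) =
      t' (Submodule.Quotient.mk m) := fun m => by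
    have h1 : d' (h' (Submodule.Quotient.mk m)) = Submodule.Quotient.mk (d (h m)) := by
      rw [← hh]; rfl
    have h2 : h' (d' (Submodule.Quotient.mk m)) = Submodule.Quotient.mk (h (d m)) := by
      rw [hh]; rfl
    simp [t, t', h1, h2]
  let n := t * t - t
  have hn : ∀ m, n m ∈ radical k V M.carrier := fun m => by
    rw [← Submodule.Quotient.mk_eq_zero]
    have : (Submodule.Quotient.mk (n m) : _ ⧸ radical k V M.carrier) =
        (t' * t' - t') (Submodule.Quotient.mk m) := by
      simp [n, htt']
    rw [this, ht', sub_self, LinearMap.zero_apply]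
  have hnn : n * n = 0 := LinearMap.ext fun m => eq_zero_of_forall_mem_radical n hn (hn m)
  have htd : t * d = d * t := by
    have h1 : t * d = d * h * d + h * (d * d) := by simp only [t]; noncomm_ring
    have h2 : d * t = d * d * h + d * h * d := by simp only [t]; noncomm_ring
    rw [h1, h2, hd]; simp
  -- the idempotent `e = 3 t² - 2 t³` lifts it and is null-homotopic; `q` is `3 t - 2 t²`
  let q := t + t + t - (t * t + t * t)
  let e := t * q
  have hqd : q * d = d * q := by
    have h1 : t * t * d = d * (t * t) := by rw [mul_assoc, htd, ← mul_assoc, htd, mul_assoc]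
    simp only [q, sub_mul, add_mul, mul_sub, mul_add, h1, htd]
  have hed : e * d = d * e := by
    rw [mul_assoc, hqd, ← mul_assoc, htd, mul_assoc]
  have hee : e * e = e := by
    have : e * e - e = - ((n * n) * (3 + 4 * t - 4 * (t * t))) := by
      simp only [e, q, n]; noncomm_ring
    rw [hnn, zero_mul, neg_zero, sub_eq_zero] at this
    exact this
  have hA : ∀ x ∈ LinearMap.range e, M.d x ∈ LinearMap.range e := by
    rintro _ ⟨x, rfl⟩
    exact ⟨d x, LinearMap.congr_fun hed x⟩
  have hB : ∀ x ∈ LinearMap.ker e, M.d x ∈ LinearMap.ker e := fun x hx => by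
    have h1 : e (d x) = d (e x) := LinearMap.congr_fun hed x
    rw [LinearMap.mem_ker.1 hx, map_zero] at h1
    exact h1
  have hbot : LinearMap.range e = ⊥ := by
    refine hM _ _ hA hB (LinearMap.IsIdempotentElem.isCompl hee) ⟨ModuleCat.ofHom
      ((e * (h * q)).restrict fun x _ => ⟨_, rfl⟩), ?_⟩
    ext ⟨x, y, rfl⟩
    have h1 : e * (h * q) * d + d * (e * (h * q)) = e * e := by
      have h3 : e * (h * q) * d + d * (e * (h * q)) = e * h * (q * d) + (d * e) * h * q := by
        noncomm_ring
      rw [h3, hqd, ← hed]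
      have h4 : e * e = e * (t * q) := rfl
      rw [h4]
      simp only [t]
      noncomm_ring
    refine Subtype.ext ?_
    have h2 : e * e * e = e := by rw [hee, hee]
    rw [← h1] at h2
    exact (LinearMap.congr_fun h2 y).symm
  have he : e = 0 := LinearMap.range_eq_bot.1 hbot
  -- hence `t` vanishes on the top, and so does `d`
  have ht0 : t' = 0 := by
    have h1 : t' * (t' + t' + t' - (t' * t' + t' * t')) = t' := by
      rw [ht', mul_sub, mul_add, mul_add, ht']
      abel
    rw [← h1]
    ext m
    have h2 : (Submodule.Quotient.mk (e m) : _ ⧸ radical k V M.carrier) =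
        (t' * (t' + t' + t' - (t' * t' + t' * t'))) (Submodule.Quotient.mk m) := by
      simp [e, q, htt']
    refine h2.symm.trans ?_
    rw [he]
    rfl
  have hd0 : d' = 0 := by
    have : t' * d' = d' * h' * d' + h' * (d' * d') := by simp only [t']; noncomm_ring
    rw [ht0, hh1, hd', zero_mul, mul_zero, add_zero] at this
    exact this.symm
  rw [← Submodule.Quotient.mk_eq_zero]
  exact LinearMap.congr_fun hd0 (Submodule.Quotient.mk x)

end DiffMod

/-! ### The top functor -/

namespace RadSqZero

variable {k V : Type u} [Field k] [Quiver.{u} V] [Fintype V] [∀ i j : V, Fintype (i ⟶ j)]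

section Coefficient

variable {M N : Type*} [AddCommGroup M] [Module (RadSqZero k V) M]
  [AddCommGroup N] [Module (RadSqZero k V) N]

/-- The quotient map onto the top `M / rad M`. -/
noncomputable def toTop (k V : Type u) [Field k] [Quiver.{u} V] [Fintype V]
    (M : Type*) [AddCommGroup M] [Module (RadSqZero k V) M] :
    M →ₗ[RadSqZero k V] M ⧸ Module.jacobson (RadSqZero k V) M :=
  Submodule.mkQ _

omit [∀ i j : V, Fintype (i ⟶ j)] in
theorem toTop_surjective : Function.Surjective (toTop k V M) :=
  Submodule.mkQ_surjective _

theorem toTop_eq_zero_iff {x : M} : toTop k V M x = 0 ↔ x ∈ radical k V M := by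
  rw [← jacobson_eq_radical]
  exact Submodule.Quotient.mk_eq_zero _

theorem arrow_smul_top {i j : V} (a : i ⟶ j) (t : M ⧸ Module.jacobson (RadSqZero k V) M) :
    arrow k a • t = 0 := by
  obtain ⟨x, rfl⟩ := toTop_surjective t
  rw [← map_smul, toTop_eq_zero_iff]
  exact arrow_smul_mem_radical a x

variable (k) in
open Classical in
/-- The coefficient of an element `z = ∑ b y_b` of the radical of a projective module at an arrow
`a : i ⟶ j`: the class of `e_i y_a` in the top. Elements outside of the radical get the value `0`.
-/
noncomputable def coeff {i j : V} (a : i ⟶ j) (z : M) : M ⧸ Module.jacobson (RadSqZero k V) M :=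
  if h : z ∈ radical k V M then toTop k V M (vertex k i • (mem_radical.1 h).choose i j a) else 0

section Projective

variable [Module.Projective (RadSqZero k V) M] [Module.Projective (RadSqZero k V) N]

theorem coeff_arrowSum {i j : V} (a : i ⟶ j) (y : ∀ i j : V, (i ⟶ j) → M) :
    coeff k a (arrowSum (k := k) y) = toTop k V M (vertex k i • y i j a) := by
  have h : arrowSum (k := k) y ∈ radical k V M := mem_radical.2 ⟨y, rfl⟩
  rw [coeff, dif_pos h, ← sub_eq_zero, ← map_sub, ← smul_sub, toTop_eq_zero_iff]
  have h1 : arrowSum (k := k) ((mem_radical.1 h).choose - y) = 0 := by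
    rw [map_sub, ← (mem_radical.1 h).choose_spec, sub_self]
  exact vertex_smul_mem_radical_of_arrowSum_eq_zero h1 a

theorem coeff_zero {i j : V} (a : i ⟶ j) : coeff k a (0 : M) = 0 := by
  rw [← map_zero (arrowSum (k := k) (V := V)), coeff_arrowSum]
  simp

theorem coeff_add {i j : V} (a : i ⟶ j) {z z' : M} (hz : z ∈ radical k V M)
    (hz' : z' ∈ radical k V M) : coeff k a (z + z') = coeff k a z + coeff k a z' := by
  obtain ⟨y, rfl⟩ := mem_radical.1 hz
  obtain ⟨y', rfl⟩ := mem_radical.1 hz'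
  rw [← map_add, coeff_arrowSum, coeff_arrowSum, coeff_arrowSum]
  simp

theorem coeff_smul {i j : V} (a : i ⟶ j) (x : RadSqZero k V) {z : M} (hz : z ∈ radical k V M) :
    coeff k a (x • z) = algebraMap k (RadSqZero k V) (augmentation k V x j) • coeff k a z := by
  obtain ⟨y, rfl⟩ := mem_radical.1 hz
  rw [smul_arrowSum, coeff_arrowSum, coeff_arrowSum, ← map_smul, ← mul_smul, ← mul_smul,
    Algebra.commutes]

theorem coeff_neg {i j : V} (a : i ⟶ j) {z : M} (hz : z ∈ radical k V M) :
    coeff k a (-z) = -coeff k a z := by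
  obtain ⟨y, rfl⟩ := mem_radical.1 hz
  rw [← map_neg, coeff_arrowSum, coeff_arrowSum]
  simp

theorem vertex_smul_coeff {i j : V} (a : i ⟶ j) {z : M} (hz : z ∈ radical k V M) :
    vertex k i • coeff k a z = coeff k a z := by
  obtain ⟨y, rfl⟩ := mem_radical.1 hz
  rw [coeff_arrowSum, ← map_smul, ← mul_smul, vertex_completeOrthogonalIdempotents.idem i]

/-- An element of the radical of a projective module is determined by its coefficients. -/
theorem ext_coeff {z z' : M} (hz : z ∈ radical k V M) (hz' : z' ∈ radical k V M)
    (h : ∀ (i j : V) (a : i ⟶ j), coeff k a z = coeff k a z') : z = z' := by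
  obtain ⟨y, rfl⟩ := mem_radical.1 hz
  obtain ⟨y', rfl⟩ := mem_radical.1 hz'
  rw [arrowSum_apply, arrowSum_apply]
  refine Finset.sum_congr rfl fun i _ => Finset.sum_congr rfl fun j _ =>
    Finset.sum_congr rfl fun a _ => ?_
  have h1 := h i j a
  rw [coeff_arrowSum, coeff_arrowSum, ← sub_eq_zero, ← map_sub, ← smul_sub,
    toTop_eq_zero_iff, ← arrow_smul_eq_zero_iff, smul_sub, sub_eq_zero] at h1
  exact h1

theorem coeff_map {i j : V} (a : i ⟶ j) (f : M →ₗ[RadSqZero k V] N) {z : M}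
    (hz : z ∈ radical k V M) {w : M} (hw : toTop k V M w = coeff k a z) :
    coeff k a (f z) = toTop k V N (f w) := by
  obtain ⟨y, rfl⟩ := mem_radical.1 hz
  rw [coeff_arrowSum, ← sub_eq_zero, ← map_sub, toTop_eq_zero_iff] at hw
  rw [map_arrowSum, coeff_arrowSum, ← map_smul, eq_comm, ← sub_eq_zero, ← map_sub, ← map_sub,
    toTop_eq_zero_iff]
  exact map_mem_radical f hw

end Projective

/-- Additive maps between tops that are compatible with the scalars and the vertices are linear. -/
theorem map_smul_top (g : (M ⧸ Module.jacobson (RadSqZero k V) M) →+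
      (N ⧸ Module.jacobson (RadSqZero k V) N))
    (hs : ∀ (c : k) t, g (algebraMap k (RadSqZero k V) c • t) =
      algebraMap k (RadSqZero k V) c • g t)
    (hv : ∀ (i : V) t, g (vertex k i • t) = vertex k i • g t) (x : RadSqZero k V)
    (t : M ⧸ Module.jacobson (RadSqZero k V) M) : g (x • t) = x • g t := by
  obtain ⟨x, rfl⟩ := Ideal.Quotient.mk_surjective x
  refine PathAlgebra.generation (P := fun x => ∀ t, g (Ideal.Quotient.mk _ x • t) =
    Ideal.Quotient.mk (PathAlgebra.arrowIdeal k V ^ 2) x • g t) x (fun c t => hs c t)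
    (fun i t => hv i t) (fun i j a t => ?_) (fun x y hx hy t => ?_) (fun x y hx hy t => ?_) t
  · have h1 := arrow_smul_top a t
    have h2 := arrow_smul_top a (g t)
    exact (congrArg g h1).trans ((map_zero g).trans h2.symm)
  · rw [map_add, add_smul, map_add, hx, hy, add_smul]
  · rw [map_mul, mul_smul, hx, hy, mul_smul]

/-- Maps between tops that are compatible with the scalars and the vertices lift to
homomorphisms out of projective modules. -/
theorem exists_lift_top [Module.Projective (RadSqZero k V) M]
    (g : (M ⧸ Module.jacobson (RadSqZero k V) M) →+ (N ⧸ Module.jacobson (RadSqZero k V) N))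
    (hs : ∀ (c : k) t, g (algebraMap k (RadSqZero k V) c • t) =
      algebraMap k (RadSqZero k V) c • g t)
    (hv : ∀ (i : V) t, g (vertex k i • t) = vertex k i • g t) :
    ∃ f : M →ₗ[RadSqZero k V] N, ∀ m, toTop k V N (f m) = g (toTop k V M m) := by
  let g' : (M ⧸ Module.jacobson (RadSqZero k V) M) →ₗ[RadSqZero k V]
      (N ⧸ Module.jacobson (RadSqZero k V) N) := { g with map_smul' := map_smul_top g hs hv }
  obtain ⟨f, hf⟩ := Module.projective_lifting_property (toTop k V N) (g' ∘ₗ toTop k V M)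
    toTop_surjective
  exact ⟨f, fun m => LinearMap.congr_fun hf m⟩

end Coefficient

end RadSqZero

/-- An additive map between modules over the path algebra that is compatible with the scalars, the
vertices and the arrows is linear. -/
def PathAlgebra.linearMapOfGenerators {k W X Y : Type u} [Field k] [Quiver.{u} W] [Fintype W]
    [AddCommGroup X] [Module (PathAlgebra k W) X] [AddCommGroup Y] [Module (PathAlgebra k W) Y]
    (g : X →+ Y)
    (hs : ∀ (c : k) x, g (algebraMap k (PathAlgebra k W) c • x) =
      algebraMap k (PathAlgebra k W) c • g x)
    (hv : ∀ (i : W) x, g (PathAlgebra.vertex k i • x) = PathAlgebra.vertex k i • g x)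
    (ha : ∀ (i j : W) (a : i ⟶ j) x, g (PathAlgebra.arrow k a • x) = PathAlgebra.arrow k a • g x) :
    X →ₗ[PathAlgebra k W] Y where
  __ := g
  map_smul' x t := by
    change g (x • t) = x • g t
    exact PathAlgebra.generation (P := fun x => ∀ t, g (x • t) = x • g t) x hs hv ha
      (fun x y hx hy t => by rw [add_smul, map_add, hx, hy, add_smul])
      (fun x y hx hy t => by rw [mul_smul, hx, hy, mul_smul]) t

namespace ReducedDiffProj

open RadSqZero

variable {k V : Type u} [Field k] [Quiver.{u} V] [Fintype V] [∀ i j : V, Fintype (i ⟶ j)]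

instance (M : ReducedDiffProj (RadSqZero k V)) :
    Module.Projective (RadSqZero k V) M.obj.carrier := M.property.1

theorem d_mem_radical (M : ReducedDiffProj (RadSqZero k V)) (x : M.obj.carrier) :
    M.obj.d x ∈ radical k V M.obj.carrier :=
  DiffMod.d_mem_radical M.property.1 M.property.2 x

theorem d_eq_zero_of_mem_radical (M : ReducedDiffProj (RadSqZero k V)) {x : M.obj.carrier}
    (hx : x ∈ radical k V M.obj.carrier) : M.obj.d x = 0 :=
  eq_zero_of_forall_mem_radical M.obj.d.hom M.d_mem_radical hx

/-- The top `M / rad M` of a reduced differential projective module, as a type of its own, since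
it is going to be a module over the path algebra of the opposite quiver. -/
def Top (M : ReducedDiffProj (RadSqZero k V)) : Type u :=
  M.obj.carrier ⧸ Module.jacobson (RadSqZero k V) M.obj.carrier

variable (M : ReducedDiffProj (RadSqZero k V))

noncomputable instance : AddCommGroup M.Top :=
  inferInstanceAs (AddCommGroup (M.obj.carrier ⧸ Module.jacobson (RadSqZero k V) M.obj.carrier))

noncomputable instance : Module (RadSqZero k V) M.Top :=
  inferInstanceAs
    (Module (RadSqZero k V) (M.obj.carrier ⧸ Module.jacobson (RadSqZero k V) M.obj.carrier))

noncomputable instance : Module k M.Top := Module.compHom _ (algebraMap k (RadSqZero k V))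

instance : IsScalarTower k (RadSqZero k V) M.Top := IsScalarTower.of_algebraMap_smul fun _ _ => rfl

/-- The quotient map onto the top. -/
noncomputable def mk : M.obj.carrier →ₗ[RadSqZero k V] M.Top := toTop k V M.obj.carrier

omit [∀ i j : V, Fintype (i ⟶ j)] in
theorem mk_surjective : Function.Surjective M.mk := toTop_surjective

theorem mk_eq_zero_iff {x : M.obj.carrier} : M.mk x = 0 ↔ x ∈ radical k V M.obj.carrier :=
  toTop_eq_zero_iff

omit [∀ i j : V, Fintype (i ⟶ j)] in
theorem vertex_smul_mk (i : V) (x : M.obj.carrier) :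
    M.mk (vertex k i • x) = vertex k i • M.mk x := map_smul _ _ _

/-- The coefficient of an element of the radical at an arrow, see `RadSqZero.coeff`. -/
noncomputable def coeff {i j : V} (a : i ⟶ j) (z : M.obj.carrier) : M.Top :=
  RadSqZero.coeff k a z

theorem coeff_arrowSum {i j : V} (a : i ⟶ j) (y : ∀ i j : V, (i ⟶ j) → M.obj.carrier) :
    M.coeff a (arrowSum (k := k) y) = M.mk (vertex k i • y i j a) :=
  RadSqZero.coeff_arrowSum a y

section

variable {i j : V} (a : i ⟶ j) {z z' : M.obj.carrier} (hz : z ∈ radical k V M.obj.carrier)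
  (hz' : z' ∈ radical k V M.obj.carrier)

theorem coeff_zero : M.coeff a 0 = 0 := RadSqZero.coeff_zero a

include hz in
theorem coeff_neg : M.coeff a (-z) = -M.coeff a z := RadSqZero.coeff_neg a hz

include hz in
theorem vertex_smul_coeff : vertex k i • M.coeff a z = M.coeff a z :=
  RadSqZero.vertex_smul_coeff a hz

include hz in
theorem coeff_smul (x : RadSqZero k V) :
    M.coeff a (x • z) = augmentation k V x j • M.coeff a z :=
  RadSqZero.coeff_smul a x hz

include hz hz'

theorem coeff_add : M.coeff a (z + z') = M.coeff a z + M.coeff a z' :=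
  RadSqZero.coeff_add a hz hz'

theorem ext_coeff (h : ∀ (i j : V) (a : i ⟶ j), M.coeff a z = M.coeff a z') : z = z' :=
  RadSqZero.ext_coeff hz hz' h

end

/-- The action of the reversed arrow `a*` on the top: the class of `x` goes to the coefficient of
`d x` at `a`. -/
noncomputable def arrowEnd {i j : V} (a : i ⟶ j) : Module.End k M.Top :=
  have key (x : M.obj.carrier) :
      M.obj.d (Function.surjInv M.mk_surjective (M.mk x)) = M.obj.d x := by
    rw [← sub_eq_zero, ← map_sub]
    refine M.d_eq_zero_of_mem_radical ?_
    rw [← mk_eq_zero_iff, map_sub, Function.surjInv_eq M.mk_surjective, sub_self]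
  { toFun t := M.coeff a (M.obj.d (Function.surjInv M.mk_surjective t))
    map_add' s t := by
      obtain ⟨x, rfl⟩ := M.mk_surjective s
      obtain ⟨y, rfl⟩ := M.mk_surjective t
      rw [← map_add, key, key, key, map_add,
        M.coeff_add _ (M.d_mem_radical _) (M.d_mem_radical _)]
    map_smul' c t := by
      obtain ⟨x, rfl⟩ := M.mk_surjective t
      rw [← algebraMap_smul (RadSqZero k V) c (M.mk x), ← map_smul, key, key, map_smul,
        M.coeff_smul _ (M.d_mem_radical _), AlgHom.commutes]
      rfl }

theorem arrowEnd_mk {i j : V} (a : i ⟶ j) (x : M.obj.carrier) :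
    M.arrowEnd a (M.mk x) = M.coeff a (M.obj.d x) := by
  refine congrArg (M.coeff a) ?_
  rw [← sub_eq_zero, ← map_sub]
  refine M.d_eq_zero_of_mem_radical ?_
  rw [← mk_eq_zero_iff, map_sub, Function.surjInv_eq M.mk_surjective, sub_self]

omit [∀ i j : V, Fintype (i ⟶ j)] in
theorem lsmul_vertex_completeOrthogonalIdempotents :
    CompleteOrthogonalIdempotents
      (fun i : Vᵒᵖ => Algebra.lsmul k k M.Top (RadSqZero.vertex k i.unop)) :=
  (CompleteOrthogonalIdempotents.equiv Opposite.equivToOpposite.symm).2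
    (vertex_completeOrthogonalIdempotents.map (Algebra.lsmul k k M.Top).toRingHom)

/-- The action of the path algebra of the opposite quiver on the top. -/
noncomputable def topAction : PathAlgebra k Vᵒᵖ →ₐ[k] Module.End k M.Top :=
  PathAlgebra.liftAlg (fun i => Algebra.lsmul k k M.Top (vertex k i.unop))
    (fun _ _ a => M.arrowEnd a.unop)
    M.lsmul_vertex_completeOrthogonalIdempotents
    (fun i j a => by
      ext t
      obtain ⟨x, rfl⟩ := M.mk_surjective t
      rw [Module.End.mul_apply, arrowEnd_mk]
      exact M.vertex_smul_coeff _ (M.d_mem_radical _))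

noncomputable instance : Module (PathAlgebra k Vᵒᵖ) M.Top :=
  Module.compHom _ M.topAction.toRingHom

instance : IsScalarTower k (PathAlgebra k Vᵒᵖ) M.Top :=
  IsScalarTower.of_algebraMap_smul fun c t =>
    LinearMap.congr_fun (M.topAction.commutes c) t

theorem vertex_op_smul (i : V) (t : M.Top) :
    PathAlgebra.vertex k (Opposite.op i) • t = vertex k i • t := by
  have h : M.topAction (PathAlgebra.vertex k (Opposite.op i)) =
      Algebra.lsmul k k M.Top (vertex k i) := by
    rw [topAction, PathAlgebra.liftAlg_vertex]
  exact LinearMap.congr_fun h t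

theorem arrow_op_smul_mk {i j : V} (a : i ⟶ j) (x : M.obj.carrier) :
    PathAlgebra.arrow k a.op • M.mk x = M.coeff a (M.obj.d x) := by
  have h : M.topAction (PathAlgebra.arrow k a.op) = M.arrowEnd a := by
    rw [topAction, PathAlgebra.liftAlg_arrow]
    · rfl
    intro i j a
    ext t
    obtain ⟨x, rfl⟩ := M.mk_surjective t
    rw [Module.End.mul_apply, Algebra.lsmul_coe]
    change M.arrowEnd a.unop (vertex k _ • M.mk x) = _
    rw [← vertex_smul_mk, arrowEnd_mk, arrowEnd_mk, map_smul, M.coeff_smul _ (M.d_mem_radical _)]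
    classical
    rw [augmentation_vertex, Pi.single_eq_same, one_smul]
  rw [← arrowEnd_mk, ← h]
  rfl

variable {M} {N : ReducedDiffProj (RadSqZero k V)}

theorem coeff_map {i j : V} (a : i ⟶ j) (f : M.obj.carrier →ₗ[RadSqZero k V] N.obj.carrier)
    {z : M.obj.carrier} (hz : z ∈ radical k V M.obj.carrier) {w : M.obj.carrier}
    (hw : M.mk w = M.coeff a z) : N.coeff a (f z) = N.mk (f w) :=
  RadSqZero.coeff_map a f hz hw

/-- The map induced on the tops by a module homomorphism. -/
noncomputable def topMap (f : M.obj.carrier →ₗ[RadSqZero k V] N.obj.carrier) :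
    M.Top →ₗ[RadSqZero k V] N.Top :=
  Submodule.mapQ _ _ f (Module.le_comap_jacobson f)

omit [∀ i j : V, Fintype (i ⟶ j)] in
@[simp]
theorem topMap_mk (f : M.obj.carrier →ₗ[RadSqZero k V] N.obj.carrier) (x : M.obj.carrier) :
    topMap f (M.mk x) = N.mk (f x) := rfl

omit [∀ i j : V, Fintype (i ⟶ j)] in
theorem d_comm (f : M ⟶ N) (x : M.obj.carrier) :
    f.hom.hom (M.obj.d x) = N.obj.d (f.hom.hom x) :=
  congrArg (fun g : M.obj.carrier ⟶ N.obj.carrier => g x) f.hom.comm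

variable (k V) in
/-- The top functor: it sends a reduced differential projective `kQ/J²`-module to its top, on which
the reversed arrows act through the differential. -/
noncomputable def topFunctor :
    ReducedDiffProj (RadSqZero k V) ⥤ ModuleCat.{u} (PathAlgebra k Vᵒᵖ) where
  obj M := ModuleCat.of _ M.Top
  map {M N} f := ModuleCat.ofHom (PathAlgebra.linearMapOfGenerators
    (topMap f.hom.hom.hom).toAddMonoidHom
    (fun c t => by
      rw [algebraMap_smul, algebraMap_smul]
      exact map_smul (topMap f.hom.hom.hom) (algebraMap k (RadSqZero k V) c) t)
    (fun i t => by
      have h1 := M.vertex_op_smul i.unop t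
      have h2 := N.vertex_op_smul i.unop (topMap f.hom.hom.hom t)
      exact (congrArg _ h1).trans ((map_smul (topMap f.hom.hom.hom) _ _).trans h2.symm))
    (fun i j a t => by
      obtain ⟨x, rfl⟩ := M.mk_surjective t
      have h1 := M.arrow_op_smul_mk a.unop x
      have h2 := N.arrow_op_smul_mk a.unop (f.hom.hom x)
      obtain ⟨w, hw⟩ := M.mk_surjective (M.coeff a.unop (M.obj.d x))
      refine (congrArg _ h1).trans (Eq.trans ?_ h2.symm)
      rw [← d_comm, ← hw]
      exact (coeff_map a.unop f.hom.hom.hom (M.d_mem_radical x) hw).symm))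
  map_id M := by
    ext t
    obtain ⟨x, rfl⟩ := M.mk_surjective t
    rfl
  map_comp {L M N} f g := by
    ext t
    obtain ⟨x, rfl⟩ := L.mk_surjective t
    rfl

theorem topFunctor_map_mk (f : M ⟶ N) (x : M.obj.carrier) :
    (topFunctor k V).map f (M.mk x) = N.mk (f.hom.hom x) := rfl

theorem isTopFunctor_topFunctor :
    IsTopFunctor (topFunctor k V) (fun M => (AddEquiv.refl M.Top :)) where
  map_mk f x := rfl
  scalar M c t := (algebraMap_smul (M := M.Top) (PathAlgebra k Vᵒᵖ) c t).symm
  vertex M i t := (M.vertex_op_smul i t).symm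
  exists_d_eq M x := mem_radical.1 (M.d_mem_radical x)
  arrow M x y h i j a := by
    have h1 := M.arrow_op_smul_mk a x
    rw [h, ← arrowSum_apply, coeff_arrowSum] at h1
    exact h1

end ReducedDiffProj

/-! ### Fullness, exactness and null-homotopic maps -/

namespace ReducedDiffProj

open RadSqZero

variable {k V : Type u} [Field k] [Quiver.{u} V] [Fintype V] [∀ i j : V, Fintype (i ⟶ j)]
  {L M N : ReducedDiffProj (RadSqZero k V)}

/-- A module homomorphism of reduced differential projective modules commutes with the
differentials as soon as the induced map on the tops is compatible with the reversed arrows: both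
`f d` and `δ f` have values in the radical, where they have the same coefficients. -/
theorem comm_of_top_arrow (f : M.obj.carrier →ₗ[RadSqZero k V] N.obj.carrier)
    (h : ∀ (i j : V) (a : i ⟶ j) (t : M.Top), topMap f (PathAlgebra.arrow k a.op • t) =
      PathAlgebra.arrow k a.op • topMap f t) (x : M.obj.carrier) :
    f (M.obj.d x) = N.obj.d (f x) := by
  refine N.ext_coeff (map_mem_radical f (M.d_mem_radical x)) (N.d_mem_radical _)
    fun i j a => ?_
  obtain ⟨w, hw⟩ := M.mk_surjective (M.coeff a (M.obj.d x))
  rw [coeff_map a f (M.d_mem_radical x) hw, ← topMap_mk, hw, ← arrow_op_smul_mk, h, topMap_mk,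
    arrow_op_smul_mk]

theorem exists_lift_top (g : M.Top →+ N.Top)
    (hs : ∀ (c : k) t, g (c • t) = c • g t)
    (hv : ∀ (i : V) t, g (vertex k i • t) = vertex k i • g t) :
    ∃ f : M.obj.carrier →ₗ[RadSqZero k V] N.obj.carrier, ∀ x, N.mk (f x) = g (M.mk x) :=
  RadSqZero.exists_lift_top (M := M.obj.carrier) (N := N.obj.carrier) g hs hv

instance : (topFunctor k V).Full where
  map_surjective {M N} g := by
    obtain ⟨f, hf⟩ := exists_lift_top (M := M) (N := N) (g.hom.toAddMonoidHom)
      (fun c t => by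
        have h := map_smul g.hom (algebraMap k (PathAlgebra k Vᵒᵖ) c) t
        exact (congrArg g.hom (algebraMap_smul (M := M.Top) (PathAlgebra k Vᵒᵖ) c t)).symm.trans
          (h.trans (algebraMap_smul (M := N.Top) (PathAlgebra k Vᵒᵖ) c (g.hom t))))
      (fun i t => (congrArg g.hom (M.vertex_op_smul i t)).symm.trans
        ((map_smul g.hom (PathAlgebra.vertex k (Opposite.op i)) t).trans
          (N.vertex_op_smul i (g.hom t))))
    have hfg : ∀ t : M.Top, topMap f t = g.hom t := fun t => by
      obtain ⟨x, rfl⟩ := M.mk_surjective t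
      exact hf x
    refine ⟨ObjectProperty.homMk ⟨ModuleCat.ofHom f, ?_⟩, ?_⟩
    · ext x
      refine comm_of_top_arrow f (fun i j a t => ?_) x
      rw [hfg, hfg]
      exact map_smul g.hom _ t
    · ext t
      exact hfg t

theorem topFunctor_map_eq_zero_iff (f : M ⟶ N) :
    (topFunctor k V).map f = 0 ↔ ∀ x, f.hom.hom x ∈ radical k V N.obj.carrier := by
  refine ⟨fun h x => ?_, fun h => ?_⟩
  · rw [← mk_eq_zero_iff, ← topFunctor_map_mk, h]
    rfl
  · ext t
    obtain ⟨x, rfl⟩ := M.mk_surjective t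
    exact (N.mk_eq_zero_iff).2 (h x)

instance : (topFunctor k V).Additive where
  map_add {M N f g} := by
    ext t
    obtain ⟨x, rfl⟩ := M.mk_surjective t
    exact map_add N.mk _ _

/-- An endomorphism that induces the identity on the top is an isomorphism, since its difference
to the identity has square zero. -/
theorem isIso_of_topFunctor_map_eq_id (f : M ⟶ M)
    (hf : (topFunctor k V).map f = 𝟙 _) : IsIso f := by
  have h1 : (topFunctor k V).map (f - 𝟙 M) = 0 := by
    rw [Functor.map_sub, hf, CategoryTheory.Functor.map_id, sub_self]
  rw [topFunctor_map_eq_zero_iff] at h1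
  have h2 : (f - 𝟙 M) ≫ (f - 𝟙 M) = 0 := by
    ext x
    exact eq_zero_of_forall_mem_radical (f - 𝟙 M).hom.hom.hom h1 (h1 x)
  have h3 : f ≫ f = f + f - 𝟙 M := by
    simp only [Preadditive.comp_sub, Preadditive.sub_comp, Category.comp_id, Category.id_comp] at h2
    rw [← sub_eq_zero, ← h2]
    abel
  exact ⟨𝟙 M + 𝟙 M - f, by
    simp [h3], by
    simp [h3]⟩

instance : (topFunctor k V).ReflectsIsomorphisms where
  reflects {M N} f hf := by
    obtain ⟨g, hg⟩ := (topFunctor k V).map_surjective (inv ((topFunctor k V).map f))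
    have h1 : IsIso (f ≫ g) := isIso_of_topFunctor_map_eq_id _ (by simp [hg])
    have h2 : IsIso (g ≫ f) := isIso_of_topFunctor_map_eq_id _ (by simp [hg])
    have h3 : IsSplitMono f := ⟨⟨g ≫ inv (f ≫ g), by rw [← Category.assoc, IsIso.hom_inv_id]⟩⟩
    have h4 : Epi f := epi_of_epi g f
    exact isIso_of_epi_of_isSplitMono f

theorem topFunctor_map_injective (f : L ⟶ M) (g : M ⟶ N) (hf : Function.Injective f.hom.hom)
    (hfg : Function.Exact f.hom.hom g.hom.hom) (hg : Function.Surjective g.hom.hom) :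
    Function.Injective ((topFunctor k V).map f) := by
  -- the sequence of underlying modules splits, as `N` is projective
  obtain ⟨s, hs⟩ := Module.projective_lifting_property g.hom.hom.hom LinearMap.id hg
  have hsplit : Function.Injective f.hom.hom.hom ∧ ∃ s, g.hom.hom.hom ∘ₗ s = LinearMap.id :=
    ⟨hf, s, hs⟩
  obtain ⟨-, r, hr⟩ := ((Function.Exact.split_tfae' hfg).out 0 1).1 hsplit
  refine (injective_iff_map_eq_zero _).2 fun t ht => ?_
  obtain ⟨x, rfl⟩ := L.mk_surjective t
  have h1 : f.hom.hom x ∈ radical k V M.obj.carrier := M.mk_eq_zero_iff.1 ht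
  have h2 : r (f.hom.hom x) = x := LinearMap.congr_fun hr x
  exact L.mk_eq_zero_iff.2 (h2 ▸ map_mem_radical r h1)

/-- Taking the top is right exact, since elements of the radical of `N` lift to the radical of
`M`. -/
theorem topFunctor_map_exact (f : L ⟶ M) (g : M ⟶ N)
    (hfg : Function.Exact f.hom.hom g.hom.hom) (hg : Function.Surjective g.hom.hom) :
    Function.Exact ((topFunctor k V).map f) ((topFunctor k V).map g) := by
  intro t
  obtain ⟨x, rfl⟩ := M.mk_surjective t
  refine ⟨fun h => ?_, ?_⟩
  · obtain ⟨n, hn⟩ := mem_radical.1 (N.mk_eq_zero_iff.1 h)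
    choose m hm using fun i j b => hg (n i j b)
    have h1 : g.hom.hom (x - arrowSum (k := k) m) = 0 := by
      rw [map_sub, hn, sub_eq_zero]
      exact ((map_arrowSum g.hom.hom.hom m).trans (congrArg _ (by ext i j b; exact hm i j b))).symm
    obtain ⟨l, hl⟩ := (hfg _).1 h1
    refine ⟨L.mk l, ?_⟩
    have h2 : M.mk (x - arrowSum (k := k) m) = M.mk x := by
      rw [map_sub, sub_eq_self, mk_eq_zero_iff]
      exact mem_radical.2 ⟨m, rfl⟩
    exact (congrArg M.mk hl).trans h2
  · rintro ⟨s, hs⟩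
    obtain ⟨l, rfl⟩ := L.mk_surjective s
    rw [← hs]
    exact (congrArg N.mk ((hfg _).2 ⟨l, rfl⟩)).trans (map_zero N.mk)

theorem topFunctor_map_surjective (g : M ⟶ N) (hg : Function.Surjective g.hom.hom) :
    Function.Surjective ((topFunctor k V).map g) := fun t => by
  obtain ⟨y, rfl⟩ := N.mk_surjective t
  obtain ⟨x, rfl⟩ := hg y
  exact ⟨M.mk x, rfl⟩

/-- Null-homotopic maps have values in the radical, since the differentials do. -/
theorem topFunctor_map_of_nullHomotopic (f : M ⟶ N) (hf : DiffMod.NullHomotopic f.hom) :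
    (topFunctor k V).map f = 0 := by
  obtain ⟨r, hr⟩ := hf
  refine (topFunctor_map_eq_zero_iff f).2 fun x => ?_
  rw [hr]
  exact add_mem (map_mem_radical r.hom (M.d_mem_radical x)) (N.d_mem_radical (r x))

end ReducedDiffProj

/-! ### Density -/

namespace RadSqZero

open scoped TensorProduct

variable {k V : Type u} [Field k] [Quiver.{u} V] [Fintype V]

theorem vertex_op_completeOrthogonalIdempotents :
    CompleteOrthogonalIdempotents (fun i : V => PathAlgebra.vertex k (Opposite.op i)) :=
  (CompleteOrthogonalIdempotents.equiv Opposite.equivToOpposite).2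
    PathAlgebra.vertex_completeOrthogonalIdempotents

variable (k V) in
/-- The algebra homomorphism `kQ/J² → k^V → kQᵒᵖ`, through which every module over the path algebra
of the opposite quiver is a module over `kQ/J²` that is killed by the radical. -/
noncomputable def toOp : RadSqZero k V →ₐ[k] PathAlgebra k Vᵒᵖ :=
  vertex_op_completeOrthogonalIdempotents.algHom.comp (augmentation k V)

theorem toOp_apply (x : RadSqZero k V) :
    toOp k V x = ∑ i, augmentation k V x i • PathAlgebra.vertex k (Opposite.op i) :=
  vertex_op_completeOrthogonalIdempotents.algHom_apply _

theorem toOp_vertex (i : V) : toOp k V (vertex k i) = PathAlgebra.vertex k (Opposite.op i) := by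
  classical
  simp [toOp_apply, augmentation_vertex, Pi.single_apply]

theorem toOp_arrow {i j : V} (a : i ⟶ j) : toOp k V (arrow k a) = 0 := by
  simp [toOp_apply, augmentation_arrow]

theorem arrow_op_mul_toOp {i j : V} (a : i ⟶ j) (x : RadSqZero k V) :
    PathAlgebra.arrow k a.op * toOp k V x = augmentation k V x j • PathAlgebra.arrow k a.op := by
  classical
  rw [toOp_apply, Finset.mul_sum]
  have h (l : V) : PathAlgebra.arrow k a.op * PathAlgebra.vertex k (Opposite.op l) =
      if l = j then PathAlgebra.arrow k a.op else 0 := by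
    split_ifs with h
    · subst h; exact PathAlgebra.arrow_mul_vertex a.op
    · rw [← PathAlgebra.arrow_mul_vertex a.op, mul_assoc,
        vertex_op_completeOrthogonalIdempotents.ortho (Ne.symm h), mul_zero]
  simp [h]

variable (k V) (X : Type u) [AddCommGroup X] [Module (PathAlgebra k Vᵒᵖ) X] [Module k X]
  [IsScalarTower k (PathAlgebra k Vᵒᵖ) X]

/-- The `k`-linear map `x ↦ ∑ e_i ⊗ e_i x`. -/
noncomputable def tensorIncl : X →ₗ[k] RadSqZero k V ⊗[k] X :=
  ∑ i : V, TensorProduct.mk k (RadSqZero k V) X (vertex k i) ∘ₗ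
    Algebra.lsmul k k X (PathAlgebra.vertex k (Opposite.op i))

/-- The idempotent endomorphism `x ⊗ y ↦ ∑ x e_i ⊗ e_i y` of `kQ/J² ⊗ X`; its range is the tensor
product of `kQ/J²` and `X` over `k^V`. -/
noncomputable def tensorProj : RadSqZero k V ⊗[k] X →ₗ[RadSqZero k V] RadSqZero k V ⊗[k] X :=
  TensorProduct.AlgebraTensorModule.lift
    (LinearMap.toSpanSingleton (RadSqZero k V) (X →ₗ[k] RadSqZero k V ⊗[k] X) (tensorIncl k V X))

/-- The `k`-linear map from `kQ/J² ⊗ X` to `X` given by the action of `kQ/J²` on `X`. -/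
noncomputable def tensorAct : RadSqZero k V ⊗[k] X →ₗ[k] X :=
  TensorProduct.lift ((Algebra.lsmul k k X).toLinearMap ∘ₗ (toOp k V).toLinearMap)

variable {k V X}

theorem tensorIncl_apply (x : X) : tensorIncl k V X x =
    ∑ i : V, vertex k i ⊗ₜ[k] (PathAlgebra.vertex k (Opposite.op i) • x) := by
  simp [tensorIncl]

theorem tensorProj_tmul (y : RadSqZero k V) (x : X) :
    tensorProj k V X (y ⊗ₜ x) = y • tensorIncl k V X x := rfl

theorem tensorAct_tmul (y : RadSqZero k V) (x : X) :
    tensorAct k V X (y ⊗ₜ x) = toOp k V y • x := rfl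

theorem tensorIncl_vertex_smul (i : V) (x : X) :
    tensorIncl k V X (PathAlgebra.vertex k (Opposite.op i) • x) =
      vertex k i • tensorIncl k V X x := by
  classical
  simp only [tensorIncl_apply, Finset.smul_sum, TensorProduct.smul_tmul', smul_eq_mul, ← mul_smul,
    vertex_op_completeOrthogonalIdempotents.mul_eq, vertex_completeOrthogonalIdempotents.mul_eq,
    ite_smul, zero_smul]
  simp [TensorProduct.tmul_ite, TensorProduct.ite_tmul]

theorem tensorIncl_toOp_smul (y : RadSqZero k V) (x : X) :
    tensorIncl k V X (toOp k V y • x) =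
      vertexHom (augmentation k V y) • tensorIncl k V X x := by
  rw [toOp_apply, vertexHom, CompleteOrthogonalIdempotents.algHom_apply]
  simp only [Finset.sum_smul, map_sum, smul_assoc, map_smul, tensorIncl_vertex_smul]

theorem tensorProj_tensorIncl (x : X) :
    tensorProj k V X (tensorIncl k V X x) = tensorIncl k V X x := by
  rw [tensorIncl_apply, map_sum]
  simp only [tensorProj_tmul, ← tensorIncl_vertex_smul, ← mul_smul,
    (vertex_op_completeOrthogonalIdempotents.idem _).eq]
  rw [← map_sum, ← Finset.sum_smul, vertex_op_completeOrthogonalIdempotents.complete, one_smul,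
    tensorIncl_apply]

theorem tensorProj_tensorProj (w : RadSqZero k V ⊗[k] X) :
    tensorProj k V X (tensorProj k V X w) = tensorProj k V X w := by
  induction w with
  | zero => simp
  | tmul y x => rw [tensorProj_tmul, map_smul, tensorProj_tensorIncl]
  | add w w' h h' => rw [map_add, map_add, h, h']

theorem tensorAct_smul (y : RadSqZero k V) (w : RadSqZero k V ⊗[k] X) :
    tensorAct k V X (y • w) = toOp k V y • tensorAct k V X w := by
  induction w with
  | zero => simp
  | tmul z x =>
    rw [TensorProduct.smul_tmul', tensorAct_tmul, tensorAct_tmul, smul_eq_mul, map_mul, mul_smul]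
  | add w w' h h' => rw [smul_add, map_add, map_add, smul_add, h, h']

theorem tensorAct_tensorIncl (x : X) : tensorAct k V X (tensorIncl k V X x) = x := by
  rw [tensorIncl_apply, map_sum]
  simp only [tensorAct_tmul, toOp_vertex, ← mul_smul,
    (vertex_op_completeOrthogonalIdempotents.idem _).eq]
  rw [← Finset.sum_smul, vertex_op_completeOrthogonalIdempotents.complete, one_smul]

variable (k V X) in
/-- The projective `kQ/J²`-module with top `X`. -/
def ProjCover : Type u := LinearMap.range (tensorProj k V X)

noncomputable instance : AddCommGroup (ProjCover k V X) :=
  inferInstanceAs (AddCommGroup (LinearMap.range (tensorProj k V X)))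

noncomputable instance : Module (RadSqZero k V) (ProjCover k V X) :=
  inferInstanceAs (Module (RadSqZero k V) (LinearMap.range (tensorProj k V X)))

noncomputable instance : Module k (ProjCover k V X) :=
  inferInstanceAs (Module k (LinearMap.range (tensorProj k V X)))

instance : IsScalarTower k (RadSqZero k V) (ProjCover k V X) :=
  inferInstanceAs (IsScalarTower k (RadSqZero k V) (LinearMap.range (tensorProj k V X)))

variable (k V X) in
/-- The projection of `kQ/J² ⊗ X` onto the projective module with top `X`. -/
noncomputable def coverOf : RadSqZero k V ⊗[k] X →ₗ[RadSqZero k V] ProjCover k V X :=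
  (tensorProj k V X).rangeRestrict

variable (k V X) in
/-- The inclusion of the projective module with top `X` into `kQ/J² ⊗ X`. -/
noncomputable def coverVal : ProjCover k V X →ₗ[RadSqZero k V] RadSqZero k V ⊗[k] X :=
  (LinearMap.range (tensorProj k V X)).subtype

theorem coverOf_coverVal (z : ProjCover k V X) : coverOf k V X (coverVal k V X z) = z := by
  obtain ⟨_, w, rfl⟩ := z
  exact Subtype.ext (tensorProj_tensorProj w)

instance : Module.Projective (RadSqZero k V) (ProjCover k V X) :=
  Module.Projective.of_split (coverVal k V X) (coverOf k V X) (LinearMap.ext coverOf_coverVal)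

variable (k V X) in
/-- The map `x ↦ ∑ e_i ⊗ e_i x`, a section of the projection of the projective cover to `X`. -/
noncomputable def coverIncl : X →ₗ[k] ProjCover k V X :=
  (coverOf k V X).restrictScalars k ∘ₗ tensorIncl k V X

variable (k V X) in
/-- The projection of the projective cover to `X`. -/
noncomputable def coverProj : ProjCover k V X →ₗ[k] X :=
  tensorAct k V X ∘ₗ (coverVal k V X).restrictScalars k

theorem coverProj_coverIncl (x : X) : coverProj k V X (coverIncl k V X x) = x :=
  (congrArg (tensorAct k V X) (tensorProj_tensorIncl x)).trans (tensorAct_tensorIncl x)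

theorem coverProj_smul (y : RadSqZero k V) (z : ProjCover k V X) :
    coverProj k V X (y • z) = toOp k V y • coverProj k V X z :=
  (congrArg (tensorAct k V X) (map_smul (coverVal k V X) y z)).trans (tensorAct_smul y _)

theorem coverIncl_vertex_smul (i : V) (x : X) :
    coverIncl k V X (PathAlgebra.vertex k (Opposite.op i) • x) = vertex k i • coverIncl k V X x :=
  (congrArg (coverOf k V X) (tensorIncl_vertex_smul i x)).trans (map_smul (coverOf k V X) _ _)

theorem coverIncl_toOp_smul (y : RadSqZero k V) (x : X) :
    coverIncl k V X (toOp k V y • x) = vertexHom (augmentation k V y) • coverIncl k V X x :=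
  (congrArg (coverOf k V X) (tensorIncl_toOp_smul y x)).trans (map_smul (coverOf k V X) _ _)

variable [∀ i j : V, Fintype (i ⟶ j)]

theorem sub_coverIncl_mem_radical (z : ProjCover k V X) :
    z - coverIncl k V X (coverProj k V X z) ∈ radical k V (ProjCover k V X) := by
  suffices h : ∀ w : RadSqZero k V ⊗[k] X,
      coverOf k V X w - coverIncl k V X (tensorAct k V X w) ∈ radical k V (ProjCover k V X) by
    have h2 := h (coverVal k V X z)
    rwa [coverOf_coverVal] at h2
  intro w
  induction w with
  | zero => simp
  | tmul y x =>
    have h1 : coverOf k V X (y ⊗ₜ x) = y • coverIncl k V X x := by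
      refine Eq.trans ?_ (map_smul (coverOf k V X) y (tensorIncl k V X x))
      exact Subtype.ext (tensorProj_tensorProj _).symm
    rw [h1, tensorAct_tmul, coverIncl_toOp_smul]
    exact smul_sub_smul_mem_radical y _
  | add w w' h h' =>
    rw [map_add, map_add, map_add, add_sub_add_comm]
    exact add_mem h h'

theorem coverProj_eq_zero {z : ProjCover k V X} (hz : z ∈ radical k V (ProjCover k V X)) :
    coverProj k V X z = 0 := by
  obtain ⟨y, rfl⟩ := mem_radical.1 hz
  simp [arrowSum_apply, coverProj_smul, toOp_arrow]

variable (k V X) in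
/-- The differential of the projective cover of a module `X` over the path algebra of the opposite
quiver: it is `∑ a (a* x)` on the image of `x`. -/
noncomputable def coverDiff : Module.End (RadSqZero k V) (ProjCover k V X) where
  toFun z := arrowSum (k := k) fun _ _ a =>
    coverIncl k V X (PathAlgebra.arrow k a.op • coverProj k V X z)
  map_add' z z' := by
    refine Eq.trans (congrArg _ ?_) (map_add (arrowSum (k := k) (V := V)) _ _)
    ext i j a : 3
    simp
  map_smul' y z := by
    rw [RingHom.id_apply, smul_arrowSum]
    congr 1
    ext i j a : 3
    rw [coverProj_smul, ← mul_smul, arrow_op_mul_toOp, smul_assoc, map_smul]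
    exact (algebraMap_smul (RadSqZero k V) _ _).symm

theorem coverDiff_mem_radical (z : ProjCover k V X) :
    coverDiff k V X z ∈ radical k V (ProjCover k V X) := mem_radical.2 ⟨_, rfl⟩

variable (k V X) in
/-- The projective cover of a module over the path algebra of the opposite quiver, as a reduced
differential projective module. -/
noncomputable def diffCover : ReducedDiffProj (RadSqZero k V) where
  obj :=
    { carrier := ModuleCat.of _ (ProjCover k V X)
      d := ModuleCat.ofHom (coverDiff k V X)
      d_sq := by
        ext z : 2
        exact eq_zero_of_forall_mem_radical (M := ProjCover k V X) (coverDiff k V X)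
          coverDiff_mem_radical (coverDiff_mem_radical z) }
  property := ⟨(inferInstance : Module.Projective (RadSqZero k V) (ProjCover k V X)),
    DiffMod.isReduced_of_forall_mem_radical coverDiff_mem_radical⟩

variable (k V X) in
/-- A module over the path algebra of the opposite quiver is isomorphic to the top of its
differential projective cover. -/
noncomputable def toTopDiffCover : X →ₗ[PathAlgebra k Vᵒᵖ] (diffCover k V X).Top :=
  PathAlgebra.linearMapOfGenerators
    ((diffCover k V X).mk.toAddMonoidHom.comp (coverIncl k V X).toAddMonoidHom)
    (fun c x => by
      rw [algebraMap_smul, algebraMap_smul]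
      refine (congrArg (diffCover k V X).mk (map_smul (coverIncl k V X) c x)).trans ?_
      refine (congrArg (diffCover k V X).mk
        (algebraMap_smul (RadSqZero k V) c (coverIncl k V X x)).symm).trans ?_
      exact map_smul (diffCover k V X).mk (algebraMap k (RadSqZero k V) c) (coverIncl k V X x))
    (fun i x => by
      refine (congrArg (diffCover k V X).mk (coverIncl_vertex_smul i.unop x)).trans ?_
      exact (map_smul (diffCover k V X).mk _ _).trans
        ((diffCover k V X).vertex_op_smul i.unop _).symm)
    (fun i j a x => by
      refine Eq.trans ?_
        ((diffCover k V X).arrow_op_smul_mk a.unop (coverIncl k V X x)).symm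
      refine Eq.trans ?_ ((diffCover k V X).coeff_arrowSum a.unop _).symm
      rw [coverProj_coverIncl]
      refine congrArg (diffCover k V X).mk (Eq.trans ?_ (coverIncl_vertex_smul _ _))
      rw [← mul_smul]
      exact congrArg (fun y => coverIncl k V X (y • x)) (PathAlgebra.vertex_mul_arrow a).symm)

theorem toTopDiffCover_bijective : Function.Bijective (toTopDiffCover k V X) := by
  refine ⟨(injective_iff_map_eq_zero _).2 fun x hx => ?_, fun t => ?_⟩
  · have h := coverProj_eq_zero ((diffCover k V X).mk_eq_zero_iff.1 hx)
    exact (coverProj_coverIncl x).symm.trans h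
  · obtain ⟨z, rfl⟩ := (diffCover k V X).mk_surjective t
    refine ⟨coverProj k V X z, ?_⟩
    have h := (diffCover k V X).mk_eq_zero_iff.2 (sub_coverIncl_mem_radical z)
    exact (sub_eq_zero.1 ((map_sub (diffCover k V X).mk _ _).symm.trans h)).symm

end RadSqZero

namespace ReducedDiffProj

open RadSqZero

variable {k V : Type u} [Field k] [Quiver.{u} V] [Fintype V] [∀ i j : V, Fintype (i ⟶ j)]

instance : (topFunctor k V).EssSurj where
  mem_essImage X := by
    let : Module k X := Module.compHom X (algebraMap k (PathAlgebra k Vᵒᵖ))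
    have : IsScalarTower k (PathAlgebra k Vᵒᵖ) X := IsScalarTower.of_algebraMap_smul fun _ _ => rfl
    exact ⟨diffCover k V X, ⟨(LinearEquiv.toModuleIso
      (LinearEquiv.ofBijective (toTopDiffCover k V X) toTopDiffCover_bijective)).symm⟩⟩

end ReducedDiffProj

/-! ### Coproducts -/

namespace ReducedDiffProj

open RadSqZero

variable {k V : Type u} [Field k] [Quiver.{u} V] [Fintype V] [∀ i j : V, Fintype (i ⟶ j)]
  {I : Type u} (Z : I → ReducedDiffProj (RadSqZero k V))

/-- The differential of a direct sum of differential modules. -/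
noncomputable def directSumDiff :
    Module.End (RadSqZero k V) (Π₀ i, (Z i).obj.carrier) :=
  DFinsupp.mapRange.linearMap fun i => (Z i).obj.d.hom

omit [∀ i j : V, Fintype (i ⟶ j)] in
open Classical in
theorem directSumDiff_single (i : I) (x : (Z i).obj.carrier) :
    directSumDiff Z (DFinsupp.single i x) = DFinsupp.single i ((Z i).obj.d x) :=
  DFinsupp.mapRange_single (hf := fun i => map_zero (Z i).obj.d.hom)

theorem directSumDiff_mem_radical (z : Π₀ i, (Z i).obj.carrier) :
    directSumDiff Z z ∈ radical k V (Π₀ i, (Z i).obj.carrier) := by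
  classical
  induction z using DFinsupp.induction with
  | h0 => rw [map_zero]; exact zero_mem _
  | ha i x z _ _ hz =>
    rw [map_add, directSumDiff_single]
    exact add_mem (map_mem_radical (DFinsupp.lsingle (M := fun i => (Z i).obj.carrier) i)
      ((Z i).d_mem_radical x)) hz

/-- The direct sum of a family of reduced differential projective modules. -/
noncomputable def directSum : ReducedDiffProj (RadSqZero k V) where
  obj :=
    { carrier := ModuleCat.of _ (Π₀ i, (Z i).obj.carrier)
      d := ModuleCat.ofHom (directSumDiff Z)
      d_sq := by
        ext z : 2
        exact eq_zero_of_forall_mem_radical (M := Π₀ i, (Z i).obj.carrier) (directSumDiff Z)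
          (directSumDiff_mem_radical Z) (directSumDiff_mem_radical Z z) }
  property := ⟨(inferInstance : Module.Projective (RadSqZero k V) (Π₀ i, (Z i).obj.carrier)),
    DiffMod.isReduced_of_forall_mem_radical (directSumDiff_mem_radical Z)⟩

open Classical in
/-- The inclusion of a summand in the direct sum. -/
noncomputable def directSumIncl (i : I) : Z i ⟶ directSum Z :=
  ObjectProperty.homMk
    { hom := ModuleCat.ofHom (DFinsupp.lsingle (M := fun i => (Z i).obj.carrier) i)
      comm := by
        ext x : 2
        exact (directSumDiff_single Z i x).symm }

open Classical in
/-- The map out of the direct sum given by a family of maps out of the summands. -/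
noncomputable def directSumDesc {N : ReducedDiffProj (RadSqZero k V)} (f : ∀ i, Z i ⟶ N) :
    directSum Z ⟶ N :=
  ObjectProperty.homMk
    { hom := ModuleCat.ofHom (DFinsupp.lsum ℕ fun i => (f i).hom.hom.hom)
      comm := by
        ext1
        refine DFinsupp.lhom_ext fun i x => ?_
        have h1 : (DFinsupp.lsum ℕ fun i => (f i).hom.hom.hom)
            (directSumDiff Z (DFinsupp.single i x)) = (f i).hom.hom ((Z i).obj.d x) := by
          rw [directSumDiff_single]
          exact DFinsupp.lsum_single ℕ _ _ _
        have h2 : N.obj.d ((DFinsupp.lsum ℕ fun i => (f i).hom.hom.hom) (DFinsupp.single i x)) =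
            N.obj.d ((f i).hom.hom x) :=
          congrArg N.obj.d (DFinsupp.lsum_single (R := RadSqZero k V) ℕ
            (fun i => (f i).hom.hom.hom) i x)
        exact h1.trans ((d_comm (f i) x).trans h2.symm) }

theorem directSumIncl_desc {N : ReducedDiffProj (RadSqZero k V)} (f : ∀ i, Z i ⟶ N) (i : I) :
    directSumIncl Z i ≫ directSumDesc Z f = f i := by
  classical
  ext x
  exact DFinsupp.lsum_single (R := RadSqZero k V) ℕ (fun i => (f i).hom.hom.hom) i x

theorem directSum_hom_ext {N : ReducedDiffProj (RadSqZero k V)} {f g : directSum Z ⟶ N}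
    (h : ∀ i, directSumIncl Z i ≫ f = directSumIncl Z i ≫ g) : f = g := by
  classical
  ext1
  ext1
  ext1
  refine DFinsupp.lhom_ext fun i x => ?_
  exact congrArg (fun f : Z i ⟶ N => f.hom.hom x) (h i)

/-- The direct sum as a cofan. -/
noncomputable def directSumCofan : Cofan Z := Cofan.mk (directSum Z) (directSumIncl Z)

/-- The direct sum is a coproduct. -/
noncomputable def directSumIsColimit : IsColimit (directSumCofan Z) :=
  Cofan.IsColimit.mk _ (fun s => directSumDesc Z s.inj) (fun s => directSumIncl_desc Z s.inj)
    (fun s _ hm => directSum_hom_ext Z fun i => (hm i).trans (directSumIncl_desc Z s.inj i).symm)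

variable (k V) in
theorem hasCoproducts : HasCoproducts.{u} (ReducedDiffProj (RadSqZero k V)) :=
  hasCoproducts_of_colimit_cofans (fun Z => directSumCofan Z) (fun Z => directSumIsColimit Z)

theorem topFunctor_directSum_hom_ext {X : ModuleCat.{u} (PathAlgebra k Vᵒᵖ)}
    {f g : (topFunctor k V).obj (directSum Z) ⟶ X}
    (h : ∀ i : I, (topFunctor k V).map (directSumIncl Z i) ≫ f =
      (topFunctor k V).map (directSumIncl Z i) ≫ g) : f = g := by
  classical
  ext t
  obtain ⟨z, rfl⟩ := (directSum Z).mk_surjective t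
  change Π₀ i, (Z i).obj.carrier at z
  induction z using DFinsupp.induction with
  | h0 =>
    have h0 : (directSum Z).mk (0 : Π₀ i, (Z i).obj.carrier) = 0 := map_zero (directSum Z).mk
    rw [h0]
    exact (map_zero f.hom).trans (map_zero g.hom).symm
  | ha i x z _ _ hz =>
    have h1 : (directSum Z).mk (DFinsupp.single i x + z : Π₀ i, (Z i).obj.carrier) =
        (directSum Z).mk (DFinsupp.single i x : Π₀ i, (Z i).obj.carrier) + (directSum Z).mk z :=
      map_add (directSum Z).mk _ _
    rw [h1]
    refine (map_add f.hom _ _).trans (Eq.trans ?_ (map_add g.hom _ _).symm)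
    exact congrArg₂ (· + ·)
      (congrArg (fun f : (topFunctor k V).obj (Z i) ⟶ X => f.hom ((Z i).mk x)) (h i)) hz

/-- The image of the direct sum under the top functor is a coproduct: maps out of it exist because
the top functor is full and dense. -/
noncomputable def topFunctorDirectSumIsColimit :
    IsColimit (Cofan.mk ((topFunctor k V).obj (directSum Z))
      fun i => (topFunctor k V).map (directSumIncl Z i)) :=
  Cofan.IsColimit.mk _
    (fun s => (topFunctor k V).map (directSumDesc Z fun i => (topFunctor k V).preimage
      (s.inj i ≫ ((topFunctor k V).objObjPreimageIso s.pt).inv)) ≫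
      ((topFunctor k V).objObjPreimageIso s.pt).hom)
    (fun s i => by
      refine ((topFunctor k V).map_comp_assoc _ _ _).symm.trans ?_
      rw [directSumIncl_desc, Functor.map_preimage, Category.assoc, Iso.inv_hom_id,
        Category.comp_id])
    (fun s m hm => topFunctor_directSum_hom_ext Z fun i => by
      refine (hm i).trans ?_
      rw [← (topFunctor k V).map_comp_assoc, directSumIncl_desc, Functor.map_preimage,
        Category.assoc, Iso.inv_hom_id, Category.comp_id])

instance (I : Type u) : PreservesColimitsOfShape (Discrete I) (topFunctor k V) := by
  have (Z : I → ReducedDiffProj (RadSqZero k V)) :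
      PreservesColimit (Discrete.functor Z) (topFunctor k V) :=
    preservesColimit_of_preserves_colimit_cocone (directSumIsColimit Z)
      ((isColimitMapCoconeCofanMkEquiv _ _ _).symm (topFunctorDirectSumIsColimit Z))
  exact preservesColimitsOfShape_of_discrete _

end ReducedDiffProj

/-! ### Radical-valued homomorphisms and extensions of tops -/

namespace ReducedDiffProj

open RadSqZero

variable {k V : Type u} [Field k] [Quiver.{u} V] [Fintype V] [∀ i j : V, Fintype (i ⟶ j)]
  {M N : ReducedDiffProj (RadSqZero k V)}

/-- The two actions on the top, of `kQ/J²` and of the path algebra of the opposite quiver, agree on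
the vertices. -/
theorem toOp_smul_top (x : RadSqZero k V) (t : M.Top) : toOp k V x • t = x • t := by
  obtain ⟨m, rfl⟩ := M.mk_surjective t
  have h : M.mk (x • m) = M.mk (vertexHom (augmentation k V x) • m) := by
    rw [← sub_eq_zero, ← map_sub, mk_eq_zero_iff]
    exact smul_sub_smul_mem_radical x m
  rw [← map_smul M.mk x m, h, map_smul, toOp_apply, vertexHom,
    CompleteOrthogonalIdempotents.algHom_apply, Finset.sum_smul, Finset.sum_smul]
  exact Finset.sum_congr rfl fun i _ => by rw [smul_assoc, vertex_op_smul, smul_assoc]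

theorem arrow_op_smul_smul {i j : V} (a : i ⟶ j) (x : RadSqZero k V) (t : M.Top) :
    PathAlgebra.arrow k a.op • x • t = augmentation k V x j • PathAlgebra.arrow k a.op • t := by
  rw [← toOp_smul_top, ← mul_smul, arrow_op_mul_toOp, smul_assoc]

variable (N) in
/-- The element of the radical with prescribed coefficients. -/
noncomputable def ofCoeff (φ : ∀ i j : V, (i ⟶ j) → N.Top) : N.obj.carrier :=
  arrowSum (k := k) fun i j a => Function.surjInv N.mk_surjective (φ i j a)

theorem ofCoeff_mem_radical (φ : ∀ i j : V, (i ⟶ j) → N.Top) :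
    N.ofCoeff φ ∈ radical k V N.obj.carrier := mem_radical.2 ⟨_, rfl⟩

theorem coeff_ofCoeff (φ : ∀ i j : V, (i ⟶ j) → N.Top) {i j : V} (a : i ⟶ j) :
    N.coeff a (N.ofCoeff φ) = vertex k i • φ i j a := by
  rw [ofCoeff, coeff_arrowSum, vertex_smul_mk, Function.surjInv_eq N.mk_surjective]

theorem coeff_sub {i j : V} (a : i ⟶ j) {z z' : N.obj.carrier}
    (hz : z ∈ radical k V N.obj.carrier) (hz' : z' ∈ radical k V N.obj.carrier) :
    N.coeff a (z - z') = N.coeff a z - N.coeff a z' := by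
  rw [sub_eq_add_neg, N.coeff_add a hz (neg_mem hz'), N.coeff_neg a hz', ← sub_eq_add_neg]

section Presentation

variable {P : Type u} [AddCommGroup P] [Module (PathAlgebra k Vᵒᵖ) P] [Module k P]
  [IsScalarTower k (PathAlgebra k Vᵒᵖ) P] (π : P →ₗ[PathAlgebra k Vᵒᵖ] M.Top)

/-- A surjection onto the top has a section that is compatible with the scalars and the vertices. -/
theorem exists_vertexSection (hπ : Function.Surjective π) : ∃ σ : M.Top →ₗ[k] P,
    (∀ t, π (σ t) = t) ∧ ∀ (x : RadSqZero k V) t, σ (x • t) = toOp k V x • σ t := by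
  obtain ⟨s, hs⟩ := (π.restrictScalars k).exists_rightInverse_of_surjective
    (LinearMap.range_eq_top.2 hπ)
  -- average the section over the vertices
  let σ : M.Top →ₗ[k] P := ∑ i : V, Algebra.lsmul k k P (PathAlgebra.vertex k (Opposite.op i)) ∘ₗ
    s ∘ₗ Algebra.lsmul k k M.Top (PathAlgebra.vertex k (Opposite.op i))
  have hσ (t : M.Top) : σ t = ∑ i : V, PathAlgebra.vertex k (Opposite.op i) •
      s (PathAlgebra.vertex k (Opposite.op i) • t) := by
    simp [σ]
  have hv (i : V) (t : M.Top) : σ (PathAlgebra.vertex k (Opposite.op i) • t) =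
      PathAlgebra.vertex k (Opposite.op i) • σ t := by
    classical
    simp only [hσ, Finset.smul_sum, ← mul_smul, vertex_op_completeOrthogonalIdempotents.mul_eq,
      ite_smul, zero_smul]
    rw [Finset.sum_eq_single i, Finset.sum_eq_single i]
    · simp
    · intro l _ hl; simp [hl.symm]
    · simp
    · intro l _ hl; simp [hl]
    · simp
  refine ⟨σ, fun t => ?_, fun x t => ?_⟩
  · have h (t : M.Top) : π (s t) = t := LinearMap.congr_fun hs t
    rw [hσ, map_sum]
    simp only [map_smul, h, ← mul_smul, (vertex_op_completeOrthogonalIdempotents.idem _).eq]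
    rw [← Finset.sum_smul, vertex_op_completeOrthogonalIdempotents.complete, one_smul]
  · rw [← toOp_smul_top, toOp_apply, Finset.sum_smul, Finset.sum_smul, map_sum]
    simp only [smul_assoc, map_smul, hv]

variable (σ : M.Top →ₗ[k] P) (hσ : ∀ t, π (σ t) = t)
  (hσ' : ∀ (x : RadSqZero k V) t, σ (x • t) = toOp k V x • σ t)

/-- The failure of a section to be compatible with a reversed arrow. -/
noncomputable def defect {i j : V} (a : i ⟶ j) (t : M.Top) : LinearMap.ker π :=
  ⟨PathAlgebra.arrow k a.op • σ t - σ (PathAlgebra.arrow k a.op • t), by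
    rw [LinearMap.mem_ker, map_sub, map_smul, hσ, hσ, sub_self]⟩

omit [IsScalarTower k (PathAlgebra k Vᵒᵖ) P] in
theorem defect_add {i j : V} (a : i ⟶ j) (s t : M.Top) :
    defect π σ hσ a (s + t) = defect π σ hσ a s + defect π σ hσ a t := by
  refine Subtype.ext ?_
  simp only [defect, map_add, smul_add, Submodule.coe_add]
  abel

include hσ' in
theorem defect_smul {i j : V} (a : i ⟶ j) (x : RadSqZero k V) (t : M.Top) :
    defect π σ hσ a (x • t) =
      algebraMap k (PathAlgebra k Vᵒᵖ) (augmentation k V x j) • defect π σ hσ a t := by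
  refine Subtype.ext ?_
  simp only [defect, Submodule.coe_smul]
  rw [hσ', ← mul_smul, arrow_op_mul_toOp, arrow_op_smul_smul, map_smul, smul_assoc, ← smul_sub,
    algebraMap_smul]

omit [IsScalarTower k (PathAlgebra k Vᵒᵖ) P] in
include hσ' in
theorem vertex_smul_defect {i j : V} (a : i ⟶ j) (t : M.Top) :
    PathAlgebra.vertex k (Opposite.op i) • defect π σ hσ a t = defect π σ hσ a t := by
  refine Subtype.ext ?_
  simp only [defect, Submodule.coe_smul]
  rw [smul_sub, ← mul_smul, PathAlgebra.vertex_mul_arrow a.op, ← toOp_vertex, ← hσ',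
    ← vertex_op_smul, ← mul_smul, PathAlgebra.vertex_mul_arrow a.op]

/-- The radical-valued homomorphism attached to a homomorphism out of the kernel of a presentation
`π` of the top: its coefficients are the values at the defects of the section. -/
noncomputable def ofKernelHom (g : LinearMap.ker π →ₗ[PathAlgebra k Vᵒᵖ] N.Top) :
    M.obj.carrier →ₗ[RadSqZero k V] N.obj.carrier where
  toFun m := N.ofCoeff fun i j a => g (defect π σ hσ a (M.mk m))
  map_add' m m' := by
    refine N.ext_coeff (ofCoeff_mem_radical _)
      (add_mem (ofCoeff_mem_radical _) (ofCoeff_mem_radical _)) fun i j a => ?_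
    rw [N.coeff_add a (ofCoeff_mem_radical _) (ofCoeff_mem_radical _), coeff_ofCoeff,
      coeff_ofCoeff, coeff_ofCoeff, map_add, defect_add, map_add, smul_add]
  map_smul' x m := by
    refine N.ext_coeff (ofCoeff_mem_radical _)
      (Submodule.smul_mem _ _ (ofCoeff_mem_radical _)) fun i j a => ?_
    rw [RingHom.id_apply, N.coeff_smul a (ofCoeff_mem_radical _), coeff_ofCoeff, coeff_ofCoeff,
      map_smul, defect_smul π σ hσ hσ', map_smul, algebraMap_smul, smul_comm]

variable (g : LinearMap.ker π →ₗ[PathAlgebra k Vᵒᵖ] N.Top)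

theorem ofKernelHom_mem_radical (m : M.obj.carrier) :
    ofKernelHom π σ hσ hσ' g m ∈ radical k V N.obj.carrier := ofCoeff_mem_radical _

theorem coeff_ofKernelHom {i j : V} (a : i ⟶ j) (m : M.obj.carrier) :
    N.coeff a (ofKernelHom π σ hσ hσ' g m) = g (defect π σ hσ a (M.mk m)) := by
  refine (coeff_ofCoeff _ a).trans ?_
  rw [← vertex_op_smul, ← map_smul, vertex_smul_defect π σ hσ hσ']

/-- A `k`-linear map out of the presentation that is compatible with the vertices and fails to be
linear by a radical-valued homomorphism `f` shows that the radical-valued homomorphism attached to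
its restriction to the kernel agrees with `f` up to a commutator with the differentials. -/
theorem exists_ofKernelHom_sub_eq (f : M.obj.carrier →ₗ[RadSqZero k V] N.obj.carrier)
    (hf : ∀ m, f m ∈ radical k V N.obj.carrier) (h : P →ₗ[k] N.Top)
    (hv : ∀ (i : V) p, h (PathAlgebra.vertex k (Opposite.op i) • p) =
      PathAlgebra.vertex k (Opposite.op i) • h p)
    (ha : ∀ (i j : V) (a : i ⟶ j) p m, π p = M.mk m → h (PathAlgebra.arrow k a.op • p) =
      PathAlgebra.arrow k a.op • h p + N.coeff a (f m))
    (hg : ∀ x : LinearMap.ker π, g x = h x) :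
    ∃ r : M.obj.carrier →ₗ[RadSqZero k V] N.obj.carrier, ∀ m,
      ofKernelHom π σ hσ hσ' g m - f m = r (M.obj.d m) - N.obj.d (r m) := by
  -- the homotopy is a lift of `-(h ∘ σ)`
  obtain ⟨r, hr⟩ := exists_lift_top (M := M) (N := N) (-(h ∘ₗ σ)).toAddMonoidHom
    (fun c t => map_smul (-(h ∘ₗ σ)) c t)
    (fun i t => by
      change -(h (σ (vertex k i • t))) = vertex k i • -(h (σ t))
      rw [hσ', toOp_vertex, hv, vertex_op_smul, smul_neg])
  have hr' (m : M.obj.carrier) : N.mk (r m) = -(h (σ (M.mk m))) := hr m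
  refine ⟨r, fun m => ?_⟩
  have h1 := ofKernelHom_mem_radical π σ hσ hσ' g m
  have h2 := map_mem_radical r (M.d_mem_radical m)
  have h3 := N.d_mem_radical (r m)
  refine N.ext_coeff (sub_mem h1 (hf m)) (sub_mem h2 h3) fun i j a => ?_
  obtain ⟨w, hw⟩ := M.mk_surjective (M.coeff a (M.obj.d m))
  rw [coeff_sub a h1 (hf m), coeff_sub a h2 h3, coeff_ofKernelHom,
    coeff_map a r (M.d_mem_radical m) hw, hr', hw, ← arrow_op_smul_mk, ← arrow_op_smul_mk, hr', hg]
  simp only [defect, map_sub]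
  rw [ha i j a (σ (M.mk m)) m (hσ _), smul_neg]
  abel

/-- The radical-valued homomorphism attached to a homomorphism `g` out of the kernel is a commutator
with the differentials if and only if `g` extends to the presentation. -/
theorem ofKernelHom_eq_commutator_iff :
    (∃ r : M.obj.carrier →ₗ[RadSqZero k V] N.obj.carrier, ∀ m,
      ofKernelHom π σ hσ hσ' g m = r (M.obj.d m) - N.obj.d (r m)) ↔
    ∃ h : P →ₗ[PathAlgebra k Vᵒᵖ] N.Top, g = h ∘ₗ (LinearMap.ker π).subtype := by
  constructor
  · rintro ⟨r, hr⟩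
    have hd (i j : V) (a : i ⟶ j) (t : M.Top) : g (defect π σ hσ a t) =
        topMap r (PathAlgebra.arrow k a.op • t) - PathAlgebra.arrow k a.op • topMap r t := by
      obtain ⟨m, rfl⟩ := M.mk_surjective t
      obtain ⟨w, hw⟩ := M.mk_surjective (M.coeff a (M.obj.d m))
      rw [← coeff_ofKernelHom π σ hσ hσ', hr, coeff_sub a (map_mem_radical r (M.d_mem_radical m))
        (N.d_mem_radical (r m)), coeff_map a r (M.d_mem_radical m) hw, topMap_mk,
        arrow_op_smul_mk, arrow_op_smul_mk, ← hw, topMap_mk]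
    have hmem (p : P) : p - σ (π p) ∈ LinearMap.ker π := by
      rw [LinearMap.mem_ker, map_sub, hσ, sub_self]
    -- the extension of `g` is `p ↦ g (p - σ (π p)) - r (π p)`
    let κ : P →+ LinearMap.ker π :=
      { toFun p := ⟨p - σ (π p), hmem p⟩
        map_zero' := Subtype.ext (by simp)
        map_add' p q := Subtype.ext (by
          simp only [map_add, Submodule.coe_add]
          abel) }
    refine ⟨PathAlgebra.linearMapOfGenerators
      (g.toAddMonoidHom.comp κ - (topMap r).toAddMonoidHom.comp π.toAddMonoidHom)
      (fun c p => ?_) (fun i p => ?_) (fun i j a p => ?_), ?_⟩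
    · have h1 : κ (algebraMap k (PathAlgebra k Vᵒᵖ) c • p) =
          algebraMap k (PathAlgebra k Vᵒᵖ) c • κ p := Subtype.ext (by
        change _ - σ (π _) = algebraMap k (PathAlgebra k Vᵒᵖ) c • (p - σ (π p))
        rw [map_smul π, smul_sub, algebraMap_smul (PathAlgebra k Vᵒᵖ) c (π p),
          algebraMap_smul (PathAlgebra k Vᵒᵖ) c (σ (π p)), map_smul σ])
      have h2 : topMap r (π (algebraMap k (PathAlgebra k Vᵒᵖ) c • p)) =
          algebraMap k (PathAlgebra k Vᵒᵖ) c • topMap r (π p) := by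
        rw [map_smul, algebraMap_smul, algebraMap_smul]
        exact map_smul (topMap r) (algebraMap k (RadSqZero k V) c) (π p)
      change g (κ _) - topMap r (π _) = _ • (g (κ p) - topMap r (π p))
      rw [h1, h2, map_smul, smul_sub]
    · have h1 : κ (PathAlgebra.vertex k i • p) = PathAlgebra.vertex k i • κ p :=
        Subtype.ext (by
          change _ - σ (π _) = PathAlgebra.vertex k i • (p - σ (π p))
          rw [map_smul, smul_sub]
          have := hσ' (vertex k i.unop) (π p)
          rw [toOp_vertex, ← vertex_op_smul] at this
          rw [← this])
      have h2 : topMap r (π (PathAlgebra.vertex k i • p)) =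
          PathAlgebra.vertex k i • topMap r (π p) := by
        rw [map_smul]
        exact (congrArg (topMap r) (M.vertex_op_smul i.unop (π p))).trans
          ((map_smul (topMap r) _ _).trans (N.vertex_op_smul i.unop _).symm)
      change g (κ _) - topMap r (π _) = _ • (g (κ p) - topMap r (π p))
      rw [h1, h2, map_smul, smul_sub]
    · have h1 : κ (PathAlgebra.arrow k a • p) =
          PathAlgebra.arrow k a • κ p + defect π σ hσ a.unop (π p) := Subtype.ext (by
        change _ - σ (π _) = PathAlgebra.arrow k a • (p - σ (π p)) +
          (PathAlgebra.arrow k a • σ (π p) - σ (PathAlgebra.arrow k a • π p))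
        rw [map_smul, smul_sub]
        abel)
      change g (κ _) - topMap r (π _) = _ • (g (κ p) - topMap r (π p))
      have hd' : g (defect π σ hσ a.unop (π p)) = topMap r (PathAlgebra.arrow k a • π p) -
          PathAlgebra.arrow k a • topMap r (π p) := hd _ _ a.unop (π p)
      rw [h1, map_add, hd', map_smul g, smul_sub, map_smul π]
      abel
    · ext x
      have h1 : κ x = x := Subtype.ext (by
        change x.1 - σ (π x.1) = x.1
        rw [LinearMap.mem_ker.1 x.2, map_zero, sub_zero])
      change g x = g (κ x) - topMap r (π x)
      rw [h1, LinearMap.mem_ker.1 x.2, map_zero, sub_zero]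
  · rintro ⟨h, rfl⟩
    obtain ⟨r, hr⟩ := exists_ofKernelHom_sub_eq π σ hσ hσ' (h ∘ₗ (LinearMap.ker π).subtype) 0
      (fun m => zero_mem _) (h.restrictScalars k) (fun i p => map_smul h _ p)
      (fun i j a p m _ => by
        rw [LinearMap.zero_apply, coeff_zero, add_zero]
        exact map_smul h _ p) (fun x => rfl)
    exact ⟨r, fun m => by simpa using hr m⟩

end Presentation

end ReducedDiffProj

/-! ### Every radical-valued homomorphism comes from the kernel of a presentation -/

namespace ReducedDiffProj

open RadSqZero

variable {k V : Type u} [Field k] [Quiver.{u} V] [Fintype V] [∀ i j : V, Fintype (i ⟶ j)]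
  {M N : ReducedDiffProj (RadSqZero k V)}

/-- The extension of `M` by `N` defined by a radical-valued homomorphism `f : M → N`: the direct sum
with the differential `(n, m) ↦ (δ n + f m, d m)`. -/
noncomputable def extensionOf (f : M.obj.carrier →ₗ[RadSqZero k V] N.obj.carrier)
    (hf : ∀ m, f m ∈ radical k V N.obj.carrier) : ReducedDiffProj (RadSqZero k V) :=
  let D : DiffMod (RadSqZero k V) :=
    { carrier := ModuleCat.of _ (N.obj.carrier × M.obj.carrier)
      d := ModuleCat.ofHom
        ((N.obj.d.hom ∘ₗ LinearMap.fst _ _ _ + f ∘ₗ LinearMap.snd _ _ _).prod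
          (M.obj.d.hom ∘ₗ LinearMap.snd _ _ _))
      d_sq := by
        refine ModuleCat.hom_ext (LinearMap.ext fun x : N.obj.carrier × M.obj.carrier => ?_)
        refine Prod.ext ?_ (M.d_eq_zero_of_mem_radical (M.d_mem_radical x.2))
        have h1 : N.obj.d (N.obj.d x.1 + f x.2) = 0 :=
          N.d_eq_zero_of_mem_radical (add_mem (N.d_mem_radical _) (hf _))
        have h2 : f (M.obj.d x.2) = 0 := eq_zero_of_forall_mem_radical f hf (M.d_mem_radical _)
        exact (congrArg₂ (· + ·) h1 h2).trans (add_zero _) }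
  ⟨D, inferInstanceAs (Module.Projective _ (N.obj.carrier × M.obj.carrier)),
    DiffMod.isReduced_of_forall_mem_radical fun x : N.obj.carrier × M.obj.carrier => by
      have h1 := map_mem_radical (LinearMap.inl (RadSqZero k V) N.obj.carrier M.obj.carrier)
        (add_mem (N.d_mem_radical x.1) (hf x.2))
      have h2 := map_mem_radical (LinearMap.inr (RadSqZero k V) N.obj.carrier M.obj.carrier)
        (M.d_mem_radical x.2)
      have h3 : D.d x = LinearMap.inl (RadSqZero k V) N.obj.carrier M.obj.carrier
          (N.obj.d x.1 + f x.2) + LinearMap.inr (RadSqZero k V) N.obj.carrier M.obj.carrier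
          (M.obj.d x.2) :=
        Prod.ext (add_zero _).symm (zero_add _).symm
      rw [h3]
      exact add_mem h1 h2⟩

section

variable (f : M.obj.carrier →ₗ[RadSqZero k V] N.obj.carrier)
  (hf : ∀ m, f m ∈ radical k V N.obj.carrier)

/-- The projection of the extension of `M` by `N` to `M`. -/
noncomputable def extensionSnd : extensionOf f hf ⟶ M :=
  ObjectProperty.homMk ⟨ModuleCat.ofHom (LinearMap.snd _ N.obj.carrier M.obj.carrier), rfl⟩

/-- The projection of the extension of `M` by `N` to `N`, which need not commute with the
differentials. -/
noncomputable def extensionFst :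
    (extensionOf f hf).obj.carrier →ₗ[RadSqZero k V] N.obj.carrier :=
  LinearMap.fst _ N.obj.carrier M.obj.carrier

/-- On the top of the extension, the projection to `N` fails to be compatible with the reversed
arrows by the coefficients of `f`. -/
theorem topMap_extensionFst_arrow {i j : V} (a : i ⟶ j) (t : (extensionOf f hf).Top)
    (m : M.obj.carrier) (hm : (topFunctor k V).map (extensionSnd f hf) t = M.mk m) :
    topMap (extensionFst f hf) (PathAlgebra.arrow k a.op • t) =
      PathAlgebra.arrow k a.op • topMap (extensionFst f hf) t + N.coeff a (f m) := by
  obtain ⟨x, rfl⟩ := (extensionOf f hf).mk_surjective t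
  have hm' : M.mk (x : N.obj.carrier × M.obj.carrier).2 = M.mk m := hm
  have h1 : f (x : N.obj.carrier × M.obj.carrier).2 = f m := by
    rw [← sub_eq_zero, ← map_sub]
    refine eq_zero_of_forall_mem_radical f hf ?_
    rw [← M.mk_eq_zero_iff, map_sub, hm', sub_self]
  obtain ⟨w, hw⟩ := (extensionOf f hf).mk_surjective
    ((extensionOf f hf).coeff a ((extensionOf f hf).obj.d x))
  rw [arrow_op_smul_mk, ← hw, topMap_mk, topMap_mk, arrow_op_smul_mk,
    ← coeff_map a _ ((extensionOf f hf).d_mem_radical x) hw,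
    ← N.coeff_add a (N.d_mem_radical _) (hf m), ← h1]
  rfl

end

/-- Every radical-valued homomorphism is, up to a commutator with the differentials, attached to a
homomorphism out of the kernel of a projective presentation of the top: lift the presentation to
the top of the extension defined by `f`, and project to the top of `N`. -/
theorem exists_ofKernelHom_sub_eq_commutator {P : Type u} [AddCommGroup P]
    [Module (PathAlgebra k Vᵒᵖ) P] [Module k P] [IsScalarTower k (PathAlgebra k Vᵒᵖ) P]
    [Module.Projective (PathAlgebra k Vᵒᵖ) P] (π : P →ₗ[PathAlgebra k Vᵒᵖ] M.Top)
    (σ : M.Top →ₗ[k] P) (hσ : ∀ t, π (σ t) = t)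
    (hσ' : ∀ (x : RadSqZero k V) t, σ (x • t) = toOp k V x • σ t)
    (f : M.obj.carrier →ₗ[RadSqZero k V] N.obj.carrier)
    (hf : ∀ m, f m ∈ radical k V N.obj.carrier) :
    ∃ (g : LinearMap.ker π →ₗ[PathAlgebra k Vᵒᵖ] N.Top)
      (r : M.obj.carrier →ₗ[RadSqZero k V] N.obj.carrier), ∀ m,
      ofKernelHom π σ hσ hσ' g m - f m = r (M.obj.d m) - N.obj.d (r m) := by
  obtain ⟨ρ, hρ⟩ := Module.projective_lifting_property
    ((topFunctor k V).map (extensionSnd f hf)).hom π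
    (topFunctor_map_surjective (extensionSnd f hf) Prod.snd_surjective)
  let ρ' : P →ₗ[PathAlgebra k Vᵒᵖ] (extensionOf f hf).Top := ρ
  have hρ' (p : P) : (topFunctor k V).map (extensionSnd f hf) (ρ' p) = π p :=
    LinearMap.congr_fun hρ p
  let h : P →ₗ[k] N.Top :=
    (topMap (extensionFst f hf)).restrictScalars k ∘ₗ ρ'.restrictScalars k
  have hh (p : P) : h p = topMap (extensionFst f hf) (ρ' p) := rfl
  have hv (i : V) (p : P) : h (PathAlgebra.vertex k (Opposite.op i) • p) =
      PathAlgebra.vertex k (Opposite.op i) • h p := by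
    rw [hh, hh, map_smul, vertex_op_smul, vertex_op_smul, map_smul]
  have ha (i j : V) (a : i ⟶ j) (p : P) (m : M.obj.carrier) (hm : π p = M.mk m) :
      h (PathAlgebra.arrow k a.op • p) = PathAlgebra.arrow k a.op • h p + N.coeff a (f m) := by
    rw [hh, hh, map_smul]
    exact topMap_extensionFst_arrow f hf a (ρ' p) m ((hρ' p).trans hm)
  let g : LinearMap.ker π →ₗ[PathAlgebra k Vᵒᵖ] N.Top :=
    PathAlgebra.linearMapOfGenerators
      (h.toAddMonoidHom.comp (LinearMap.ker π).subtype.toAddMonoidHom)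
      (fun c x => by
        change h (algebraMap k (PathAlgebra k Vᵒᵖ) c • x.1) = _ • h x.1
        rw [algebraMap_smul, algebraMap_smul, map_smul])
      (fun i x => hv i.unop x.1)
      (fun i j a x => by
        have h1 := ha _ _ a.unop x.1 0 ((LinearMap.mem_ker.1 x.2).trans (map_zero _).symm)
        rw [map_zero, coeff_zero, add_zero] at h1
        exact h1)
  obtain ⟨r, hr⟩ := exists_ofKernelHom_sub_eq π σ hσ hσ' g f hf h hv ha fun x => rfl
  exact ⟨g, r, hr⟩

end ReducedDiffProj

/-! ### Morphisms in the homotopy category -/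

/-- A quotient `p : L → H` of a vector space is the direct sum of `A` and `B` if the quotient
`r : L → A` factors over `p`, and the kernel of the induced map `H → A` is the image of a space `G`
under `p θ`, with the same kernel as a surjection `e : G → B`. -/
theorem LinearMap.nonempty_linearEquiv_prod {k L H A G B : Type*} [Field k]
    [AddCommGroup L] [Module k L] [AddCommGroup H] [Module k H] [AddCommGroup A] [Module k A]
    [AddCommGroup G] [Module k G] [AddCommGroup B] [Module k B]
    (p : L →ₗ[k] H) (r : L →ₗ[k] A) (θ : G →ₗ[k] L) (e : G →ₗ[k] B)
    (hp : Function.Surjective p) (hr : Function.Surjective r) (he : Function.Surjective e)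
    (hpr : ∀ f, p f = 0 → r f = 0) (hrθ : ∀ g, r (θ g) = 0)
    (hker : ∀ f, r f = 0 → ∃ g, p (θ g) = p f) (hpe : ∀ g, p (θ g) = 0 ↔ e g = 0) :
    Nonempty (H ≃ₗ[k] A × B) := by
  obtain ⟨s, hs⟩ := p.exists_rightInverse_of_surjective (LinearMap.range_eq_top.2 hp)
  obtain ⟨w, hw⟩ := r.exists_rightInverse_of_surjective (LinearMap.range_eq_top.2 hr)
  obtain ⟨t, ht⟩ := e.exists_rightInverse_of_surjective (LinearMap.range_eq_top.2 he)
  replace hs (x : H) : p (s x) = x := LinearMap.congr_fun hs x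
  replace hw (x : A) : r (w x) = x := LinearMap.congr_fun hw x
  replace ht (x : B) : e (t x) = x := LinearMap.congr_fun ht x
  have hq (f : L) : r (s (p f)) = r f := by
    rw [← sub_eq_zero, ← map_sub]
    exact hpr _ (by rw [map_sub, hs, sub_self])
  refine ⟨(LinearEquiv.ofBijective ((p ∘ₗ w).coprod (p ∘ₗ θ ∘ₗ t)) ⟨?_, fun x => ?_⟩).symm⟩
  · refine (injective_iff_map_eq_zero _).2 fun x hx => ?_
    have h0 : p (w x.1) + p (θ (t x.2)) = 0 := hx
    have h1 : x.1 = 0 := by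
      have := congrArg (fun y => r (s y)) h0
      simpa only [map_add, map_zero, hq, hw, hrθ, add_zero] using this
    rw [h1, map_zero, map_zero, zero_add, hpe, ht] at h0
    exact Prod.ext h1 h0
  · obtain ⟨f, rfl⟩ := hp x
    obtain ⟨g, hg⟩ := hker (f - w (r f)) (by rw [map_sub, hw, sub_self])
    refine ⟨(r f, e g), ?_⟩
    have h1 : p (θ (t (e g))) = p (θ g) := by
      rw [← sub_eq_zero, ← map_sub, ← map_sub, hpe, map_sub, ht, sub_self]
    change p (w (r f)) + p (θ (t (e g))) = p f
    rw [h1, hg, map_sub, add_sub_cancel]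

open Abelian in
/-- Dimension shifting: the first extension group is the quotient of the homomorphisms out of the
kernel of a projective presentation by those which extend to the presentation. -/
theorem ModuleCat.exists_ext_of_presentation {k R P : Type u} [Field k] [Ring R] [Algebra k R]
    [AddCommGroup P] [Module R P] [Module.Projective R P] (X Y : ModuleCat.{u} R)
    (π : P →ₗ[R] X) (hπ : Function.Surjective π) :
    ∃ e : (ModuleCat.of R (LinearMap.ker π) ⟶ Y) →ₗ[k] Ext X Y 1, Function.Surjective e ∧
      ∀ g, e g = 0 ↔ ∃ h : P →ₗ[R] Y, g.hom = h ∘ₗ (LinearMap.ker π).subtype := by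
  have hS := LinearMap.shortExact_shortComplexKer hπ
  have : Projective (ModuleCat.of R P) := (IsProjective.iff_projective P).1 inferInstance
  let e : (ModuleCat.of R (LinearMap.ker π) ⟶ Y) →ₗ[k] Ext X Y 1 :=
    hS.extClass.precompOfLinear k Y (add_zero 1) ∘ₗ
      (Ext.linearEquiv₀ (R := k) (X := ModuleCat.of R (LinearMap.ker π)) (Y := Y)).symm.toLinearMap
  have he (g) : e g = hS.extClass.comp (Ext.mk₀ g) (add_zero 1) := rfl
  refine ⟨e, fun x => ?_, fun g => ⟨fun hg => ?_, ?_⟩⟩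
  · obtain ⟨x₁, rfl⟩ := Ext.contravariant_sequence_exact₃ hS Y x
      (Ext.eq_zero_of_projective (P := ModuleCat.of R P) _) (add_zero 1)
    obtain ⟨g, rfl⟩ := (Ext.mk₀_bijective _ _).2 x₁
    exact ⟨g, he g⟩
  · obtain ⟨x₂, hx₂⟩ := Ext.contravariant_sequence_exact₁ hS Y (Ext.mk₀ g) (add_zero 1) hg
    obtain ⟨h, rfl⟩ := (Ext.mk₀_bijective _ _).2 x₂
    rw [Ext.mk₀_comp_mk₀] at hx₂
    have h1 := (Ext.mk₀_bijective _ _).1 hx₂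
    exact ⟨h.hom, by rw [← h1]; rfl⟩
  · rintro ⟨h, hh⟩
    have h1 : g = π.shortComplexKer.f ≫ ModuleCat.ofHom h := ModuleCat.hom_ext hh
    rw [he, h1, ← Ext.mk₀_comp_mk₀]
    exact hS.extClass_comp_assoc (h := add_zero 1) _

namespace ReducedDiffProj

open RadSqZero

variable {k V : Type u} [Field k] [Quiver.{u} V] [Fintype V] [∀ i j : V, Fintype (i ⟶ j)]
  {M N : ReducedDiffProj (RadSqZero k V)}

/-- A radical-valued homomorphism is a morphism of differential modules, since both composites with
the differentials vanish. -/
noncomputable def homOfRadical (f : M.obj.carrier →ₗ[RadSqZero k V] N.obj.carrier)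
    (hf : ∀ m, f m ∈ radical k V N.obj.carrier) : M ⟶ N :=
  ObjectProperty.homMk ⟨ModuleCat.ofHom f, by
    ext m
    exact (eq_zero_of_forall_mem_radical f hf (M.d_mem_radical m)).trans
      (N.d_eq_zero_of_mem_radical (hf m)).symm⟩

section Kernel

variable {P : Type u} [AddCommGroup P] [Module (PathAlgebra k Vᵒᵖ) P] [Module k P]
  [IsScalarTower k (PathAlgebra k Vᵒᵖ) P] (π : P →ₗ[PathAlgebra k Vᵒᵖ] M.Top)
  (σ : M.Top →ₗ[k] P) (hσ : ∀ t, π (σ t) = t)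
  (hσ' : ∀ (x : RadSqZero k V) t, σ (x • t) = toOp k V x • σ t)

theorem ofKernelHom_add (g g' : LinearMap.ker π →ₗ[PathAlgebra k Vᵒᵖ] N.Top) (m : M.obj.carrier) :
    ofKernelHom π σ hσ hσ' (g + g') m =
      ofKernelHom π σ hσ hσ' g m + ofKernelHom π σ hσ hσ' g' m := by
  have h1 := ofKernelHom_mem_radical π σ hσ hσ' g m
  have h2 := ofKernelHom_mem_radical π σ hσ hσ' g' m
  refine N.ext_coeff (ofKernelHom_mem_radical _ _ _ _ _ _) (add_mem h1 h2) fun i j a => ?_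
  rw [N.coeff_add a h1 h2]
  simp only [coeff_ofKernelHom, LinearMap.add_apply]

theorem ofKernelHom_smul (c : k) (g g' : LinearMap.ker π →ₗ[PathAlgebra k Vᵒᵖ] N.Top)
    (hg : ∀ x, g' x = c • g x) (m : M.obj.carrier) :
    ofKernelHom π σ hσ hσ' g' m =
      algebraMap k (RadSqZero k V) c • ofKernelHom π σ hσ hσ' g m := by
  have h1 := ofKernelHom_mem_radical π σ hσ hσ' g m
  refine N.ext_coeff (ofKernelHom_mem_radical _ _ _ _ _ _) (Submodule.smul_mem _ _ h1)
    fun i j a => ?_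
  rw [N.coeff_smul a h1, coeff_ofKernelHom, coeff_ofKernelHom, hg, AlgHom.commutes]
  rfl

variable (N) in
/-- The radical-valued homomorphism attached to a homomorphism from the kernel of a presentation of
the top of `M` to the top of `N.shift`, as a morphism from `M` to `N`. The commutators of the
homomorphisms `M → N.shift` with the differentials are the null-homotopic maps `M → N`. -/
noncomputable def morphismOfKernelHom :
    (ModuleCat.of (PathAlgebra k Vᵒᵖ) (LinearMap.ker π) ⟶ (topFunctor k V).obj N.shift) →ₗ[k]
      (M ⟶ N) where
  toFun g := homOfRadical (ofKernelHom (N := N.shift) π σ hσ hσ' g.hom)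
    (ofKernelHom_mem_radical (N := N.shift) π σ hσ hσ' g.hom)
  map_add' g g' := by
    ext m
    exact ofKernelHom_add (N := N.shift) π σ hσ hσ' g.hom g'.hom m
  map_smul' c g := by
    ext m
    exact ofKernelHom_smul (N := N.shift) π σ hσ hσ' c g.hom (c • g).hom
      (fun x => algebraMap_smul (M := N.shift.Top) (PathAlgebra k Vᵒᵖ) c (g.hom x)) m

omit [∀ i j : V, Fintype (i ⟶ j)] in
theorem nullHomotopic_iff (f : M ⟶ N) : DiffMod.NullHomotopic f.hom ↔
    ∃ r : M.obj.carrier →ₗ[RadSqZero k V] N.shift.obj.carrier,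
      ∀ m, f.hom.hom.hom m = r (M.obj.d m) - N.shift.obj.d (r m) := by
  constructor
  · rintro ⟨r, hr⟩
    refine ⟨r.hom, fun m => ?_⟩
    rw [hr]
    exact (sub_neg_eq_add (r.hom (M.obj.d m)) (N.obj.d (r m))).symm
  · rintro ⟨r, hr⟩
    refine ⟨ModuleCat.ofHom r, ?_⟩
    ext m
    exact (hr m).trans (sub_neg_eq_add (α := N.obj.carrier) (r (M.obj.d m)) (N.obj.d (r m)))

end Kernel

omit [∀ i j : V, Fintype (i ⟶ j)] in
theorem ofReduced_map_surjective (f : (HomotopyDiffProj.ofReduced (RadSqZero k V)).obj M ⟶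
    (HomotopyDiffProj.ofReduced (RadSqZero k V)).obj N) :
    ∃ g : M ⟶ N, (HomotopyDiffProj.ofReduced (RadSqZero k V)).map g = f :=
  (HomotopyDiffProj.ofReduced (RadSqZero k V)).map_surjective f

omit [∀ i j : V, Fintype (i ⟶ j)] in
theorem ofReduced_map_eq_iff (f g : M ⟶ N) :
    (HomotopyDiffProj.ofReduced (RadSqZero k V)).map f =
      (HomotopyDiffProj.ofReduced (RadSqZero k V)).map g ↔
    DiffMod.NullHomotopic (f - g).hom :=
  Quotient.functor_map_eq_iff (DiffProj.homotopic (RadSqZero k V)) _ _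

/-- The morphisms in the homotopy category: a morphism is determined by the map it induces on the
tops, up to a radical-valued morphism, and the classes of the radical-valued morphisms are the
extensions of the tops. -/
theorem nonempty_homotopyHom_linearEquiv (M N : ReducedDiffProj (RadSqZero k V)) :
    Nonempty (((HomotopyDiffProj.ofReduced (RadSqZero k V)).obj M ⟶
        (HomotopyDiffProj.ofReduced (RadSqZero k V)).obj N) ≃ₗ[k]
      ((topFunctor k V).obj M ⟶ (topFunctor k V).obj N) ×
        Abelian.Ext ((topFunctor k V).obj M) ((topFunctor k V).obj N.shift) 1) := by
  let π : (M.Top →₀ PathAlgebra k Vᵒᵖ) →ₗ[PathAlgebra k Vᵒᵖ] M.Top :=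
    Finsupp.linearCombination _ id
  have hπ : Function.Surjective π := Finsupp.linearCombination_id_surjective _ _
  obtain ⟨σ, hσ, hσ'⟩ := exists_vertexSection π hπ
  obtain ⟨e, he, hker⟩ := ModuleCat.exists_ext_of_presentation (k := k) ((topFunctor k V).obj M)
    ((topFunctor k V).obj N.shift) π hπ
  let p : (M ⟶ N) →ₗ[k] ((HomotopyDiffProj.ofReduced (RadSqZero k V)).obj M ⟶
      (HomotopyDiffProj.ofReduced (RadSqZero k V)).obj N) :=
    { toFun f := (HomotopyDiffProj.ofReduced (RadSqZero k V)).map f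
      map_add' f g := rfl
      map_smul' c f := rfl }
  let r : (M ⟶ N) →ₗ[k] ((topFunctor k V).obj M ⟶ (topFunctor k V).obj N) :=
    { toFun f := (topFunctor k V).map f
      map_add' f g := (topFunctor k V).map_add
      map_smul' c f := by
        ext t
        obtain ⟨m, rfl⟩ := M.mk_surjective t
        exact (map_smul N.mk (algebraMap k (RadSqZero k V) c) (f.hom.hom m)).trans
          (algebraMap_smul (M := N.Top) (PathAlgebra k Vᵒᵖ) c (N.mk (f.hom.hom m))).symm }
  have hp (f g : M ⟶ N) : p f = p g ↔ DiffMod.NullHomotopic (f - g).hom :=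
    ofReduced_map_eq_iff f g
  have hp0 (f : M ⟶ N) : p f = 0 ↔ DiffMod.NullHomotopic f.hom := by
    rw [← map_zero p, hp, sub_zero]
  refine LinearMap.nonempty_linearEquiv_prod p r (morphismOfKernelHom N π σ hσ hσ') e
    ofReduced_map_surjective (topFunctor k V).map_surjective he
    (fun f hf => topFunctor_map_of_nullHomotopic f ((hp0 f).1 hf)) (fun g => ?_) (fun f hf => ?_)
    (fun g => ?_)
  · exact (topFunctor_map_eq_zero_iff _).2
      (ofKernelHom_mem_radical (N := N.shift) π σ hσ hσ' g.hom)
  · obtain ⟨g, s, hs⟩ := exists_ofKernelHom_sub_eq_commutator (N := N.shift) π σ hσ hσ'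
      f.hom.hom.hom ((topFunctor_map_eq_zero_iff f).1 hf)
    exact ⟨ModuleCat.ofHom g, (hp _ _).2 ((nullHomotopic_iff _).2 ⟨s, hs⟩)⟩
  · exact (hp0 _).trans ((nullHomotopic_iff _).trans
      ((ofKernelHom_eq_commutator_iff (N := N.shift) π σ hσ hσ' g.hom).trans (hker g).symm))

end ReducedDiffProj

theorem theorem1p1 (k V : Type u) [Field k] [Quiver.{u} V] [Fintype V]
    [∀ i j : V, Fintype (i ⟶ j)] :
    ∃ (F : ReducedDiffProj (RadSqZero k V) ⥤ ModuleCat.{u} (PathAlgebra k Vᵒᵖ))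
      (e : ∀ M : ReducedDiffProj (RadSqZero k V),
        (M.obj.carrier ⧸ Module.jacobson (RadSqZero k V) M.obj.carrier) ≃+ F.obj M),
      -- `F` is given by taking the top
      IsTopFunctor F e ∧
      -- `F` is full, dense, and detects isomorphisms
      F.Full ∧ F.EssSurj ∧ F.ReflectsIsomorphisms ∧
      -- `F` is exact: it carries short exact sequences to short exact sequences
      (∀ {L M N : ReducedDiffProj (RadSqZero k V)} (f : L ⟶ M) (g : M ⟶ N),
        Function.Injective f.hom.hom → Function.Exact f.hom.hom g.hom.hom →
        Function.Surjective g.hom.hom →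
        Function.Injective (F.map f) ∧ Function.Exact (F.map f) (F.map g) ∧
        Function.Surjective (F.map g)) ∧
      -- small coproducts exist in the source category, and `F` commutes with them
      HasCoproducts.{u} (ReducedDiffProj (RadSqZero k V)) ∧
      (∀ I : Type u, PreservesColimitsOfShape (Discrete I) F) ∧
      -- `F` vanishes on null-homotopic maps
      (∀ {M N : ReducedDiffProj (RadSqZero k V)} (f : M ⟶ N),
        DiffMod.NullHomotopic f.hom → F.map f = 0) ∧
      -- morphisms in the homotopy category
      (∀ M N : ReducedDiffProj (RadSqZero k V),
        Nonempty (((HomotopyDiffProj.ofReduced (RadSqZero k V)).obj M ⟶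
            (HomotopyDiffProj.ofReduced (RadSqZero k V)).obj N) ≃ₗ[k]
          (F.obj M ⟶ F.obj N) × Abelian.Ext (F.obj M) (F.obj N.shift) 1)) := by
  exact ⟨ReducedDiffProj.topFunctor k V, fun M => (AddEquiv.refl M.Top :),
    ReducedDiffProj.isTopFunctor_topFunctor, inferInstance, inferInstance, inferInstance,
    fun f g hf hfg hg => ⟨ReducedDiffProj.topFunctor_map_injective f g hf hfg hg,
      ReducedDiffProj.topFunctor_map_exact f g hfg hg,
      ReducedDiffProj.topFunctor_map_surjective g hg⟩,
    ReducedDiffProj.hasCoproducts k V, fun I => inferInstance,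
    ReducedDiffProj.topFunctor_map_of_nullHomotopic,
    ReducedDiffProj.nonempty_homotopyHom_linearEquiv⟩
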